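/- Consider pairs $(f,g)$ of polynomials of degree five, each a product of cyclotomic polynomials, which have no common root and satisfy $f(0)=-1$, $g(0)=1$. Let $A,B\in\mathrm{GL}_5(\mathbb Z)$ be the companion matrices of $f,g$ and let $\Gamma(f,g)=\langle A,B\rangle$ be the hypergeometric (monodromy) group. Two pairs are identified up to scalar shift if, for some $c\in\mathbb C^*$, multiplying all roots of $f$ and of $g$ by $c$ turns the first pair into the second or into the second with its members exchanged. (The shift by $c=-1$ turns the normalization into $f(0)=1$, $g(0)=-1$, so the two members are then renamed.) The roots of $f=\prod_j(X-e^{2\pi i\alpha_j})$ and $g=\prod_j(X-e^{2\pi i\beta_j})$, with $\alpha_j,\beta_j\in[0,1)$ in increasing order, interlace if $\alpha_1<\beta_1<\alpha_2<\cdots<\alpha_5<\beta_5$ or $\beta_1<\alpha_1<\beta_2<\cdots<\beta_5<\alpha_5$. The pair is primitive if $\Gamma(f,g)$ acts irreducibly on $\mathbb C^5$ and $\mathbb C^5$ is not a direct sum of at least two nonzero subspaces permuted by $\Gamma(f,g)$. There are exactly 77 such pairs up to scalar shift. For each of them $\Gamma(f,g)$ preserves a quadratic form $\mathrm Q$ on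 $\mathbb Q^5$, non-degenerate and unique up to scalars, whose signature is stated below after multiplying $\mathrm Q$ by a suitable scalar. The 77 classes split as follows. (1) For 4 classes the roots of $f$ and $g$ interlace, $\Gamma(f,g)$ is finite, and $\mathrm Q$ has signature $(5,0)$. (2) For 17 classes $\mathrm Q$ has signature $(4,1)$. (3) For 56 classes $\mathrm Q$ has signature $(3,2)$. In cases (2) and (3) the roots do not interlace, $\Gamma(f,g)$ is infinite and the pair is primitive. Representatives are as follows, where $(d_1,\dots,d_r\,|\,e_1,\dots,e_s)$ stands for $f=\Phi_{d_1}\cdots\Phi_{d_r}$, $g=\Phi_{e_1}\cdots\Phi_{e_s}$ and every class occurs exactly once. Case (1): $(1,3,4\,|\,2,10)$, $(1,3,6\,|\,2,10)$, $(1,5\,|\,2,10)$, $(1,8\,|\,2,10)$. Case (2): $(1,1,1,3\,|\,2,8)$, $(1,1,1,3\,|\,2,12)$, $(1,1,1,4\,|\,2,10)$, $(1,1,1,6\,|\,2,10)$, $(1,3,6\,|\,2,5)$, $(1,10\,|\,2,3,4)$, $(1,10\,|\,2,8)$, $(1,1,1,3\,|\,2,2,2,4)$, $(1,1,1,3\,|\,2,2,2,6)$,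 $(1,1,1,3\,|\,2,5)$, $(1,1,1,4\,|\,2,3,6)$, $(1,1,1,4\,|\,2,5)$, $(1,1,1,4\,|\,2,8)$, $(1,1,1,4\,|\,2,12)$, $(1,1,1,6\,|\,2,8)$, $(1,1,1,6\,|\,2,12)$, $(1,10\,|\,2,5)$. Case (3): $(1,1,1,3\,|\,2,10)$, $(1,3,3\,|\,2,4,4)$, $(1,3,3\,|\,2,5)$, $(1,3,3\,|\,2,6,6)$, $(1,3,3\,|\,2,10)$, $(1,3,3\,|\,2,12)$, $(1,3,4\,|\,2,5)$, $(1,5\,|\,2,4,4)$, $(1,10\,|\,2,4,4)$, $(1,12\,|\,2,4,4)$, $(1,12\,|\,2,10)$, $(1,1,1,1,1\,|\,2,4,4)$, $(1,1,1,1,1\,|\,2,6,6)$, $(1,1,1,3\,|\,2,4,4)$, $(1,1,1,3\,|\,2,4,6)$, $(1,1,1,3\,|\,2,6,6)$, $(1,1,1,4\,|\,2,6,6)$, $(1,1,1,6\,|\,2,4,4)$, $(1,3,3\,|\,2,4,6)$, $(1,3,3\,|\,2,8)$, $(1,3,4\,|\,2,8)$, $(1,3,4\,|\,2,12)$, $(1,3,6\,|\,2,4,4)$,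 $(1,3,6\,|\,2,8)$, $(1,3,6\,|\,2,12)$, $(1,5\,|\,2,3,3)$, $(1,5\,|\,2,3,4)$, $(1,6,6\,|\,2,3,3)$, $(1,6,6\,|\,2,3,4)$, $(1,6,6\,|\,2,4,4)$, $(1,8\,|\,2,3,3)$, $(1,8\,|\,2,3,4)$, $(1,8\,|\,2,4,4)$, $(1,12\,|\,2,3,4)$, $(1,12\,|\,2,5)$, $(1,12\,|\,2,8)$, $(1,1,1,1,1\,|\,2,2,2,2,2)$, $(1,1,1,1,1\,|\,2,2,2,3)$, $(1,1,1,1,1\,|\,2,2,2,4)$, $(1,1,1,1,1\,|\,2,2,2,6)$, $(1,1,1,1,1\,|\,2,3,3)$, $(1,1,1,1,1\,|\,2,3,4)$, $(1,1,1,1,1\,|\,2,3,6)$, $(1,1,1,1,1\,|\,2,4,6)$, $(1,1,1,1,1\,|\,2,5)$, $(1,1,1,1,1\,|\,2,8)$, $(1,1,1,1,1\,|\,2,10)$, $(1,1,1,1,1\,|\,2,12)$, $(1,1,1,4\,|\,2,2,2,3)$, $(1,1,1,4\,|\,2,3,3)$, $(1,1,1,6\,|\,2,2,2,3)$, $(1,1,1,6\,|\,2,3,3)$,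 $(1,1,1,6\,|\,2,3,4)$, $(1,1,1,6\,|\,2,5)$, $(1,10\,|\,2,3,3)$, $(1,12\,|\,2,3,3)$. Among the 77 classes exactly three are not primitive, namely those of $(1,3,4\,|\,2,10)$, $(1,5\,|\,2,10)$ and $(1,8\,|\,2,10)$ in case (1). The only pair of the form $f(X)=f_1(X^k)$, $g(X)=g_1(X^k)$ with $f_1,g_1\in\mathbb Z[X]$ and $k\ge 2$ is $(X^5-1,X^5+1)$. -/

import Mathlib

open Polynomial

noncomputable section

/-! ### Pairs of degree five products of cyclotomic polynomials -/

/-- `f` is a product of cyclotomic polynomials (repetitions allowed). -/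
def IsCyclotomicProduct (f : ℤ[X]) : Prop :=
  ∃ s : Multiset ℕ, (∀ d ∈ s, 0 < d) ∧ f = (s.map fun d => cyclotomic d ℤ).prod

/-- The pairs `(f, g)` of degree five products of cyclotomic polynomials without common root and
with `f(0) = -1`, `g(0) = 1`. -/
structure IsAdmissible (p : ℤ[X] × ℤ[X]) : Prop where
  cyclotomic_fst : IsCyclotomicProduct p.1
  cyclotomic_snd : IsCyclotomicProduct p.2
  natDegree_fst : p.1.natDegree = 5
  natDegree_snd : p.2.natDegree = 5
  no_common_root : ∀ z : ℂ, ¬ (aeval z p.1 = 0 ∧ aeval z p.2 = 0)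
  eval_fst : p.1.eval 0 = -1
  eval_snd : p.2.eval 0 = 1

abbrev AdmissiblePair : Type := {p : ℤ[X] × ℤ[X] // IsAdmissible p}

/-! ### Scalar shifts -/

/-- `q` is a scalar shift of `p`: for some `c ≠ 0` the roots of `q.1` and of `q.2` (with
multiplicity) are the roots of `p.1` and of `p.2` multiplied by `c`. -/
def IsScalarShift (p q : ℤ[X] × ℤ[X]) : Prop :=
  ∃ c : ℂ, c ≠ 0 ∧
    q.1.map (Int.castRingHom ℂ) = (p.1.map (Int.castRingHom ℂ)).scaleRoots c ∧
    q.2.map (Int.castRingHom ℂ) = (p.2.map (Int.castRingHom ℂ)).scaleRoots c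

/-- Equality up to scalar shift of the pairs `{f, g}`. The two members are named by the
normalization `f(0) = -1`, `g(0) = 1`, which the shift by `-1` turns into `f(0) = 1`,
`g(0) = -1`; after such a shift the two names are exchanged. -/
def ShiftEquiv (p q : ℤ[X] × ℤ[X]) : Prop :=
  IsScalarShift p q ∨ IsScalarShift p.swap q

theorem IsScalarShift.refl (p : ℤ[X] × ℤ[X]) : IsScalarShift p p :=
  ⟨1, one_ne_zero, by simp, by simp⟩

theorem IsScalarShift.symm {p q : ℤ[X] × ℤ[X]} (h : IsScalarShift p q) : IsScalarShift q p := by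
  obtain ⟨c, hc, h1, h2⟩ := h
  refine ⟨c⁻¹, inv_ne_zero hc, ?_, ?_⟩
  · rw [h1, ← scaleRoots_mul, mul_inv_cancel₀ hc, scaleRoots_one]
  · rw [h2, ← scaleRoots_mul, mul_inv_cancel₀ hc, scaleRoots_one]

theorem IsScalarShift.trans {p q r : ℤ[X] × ℤ[X]} (h : IsScalarShift p q)
    (h' : IsScalarShift q r) : IsScalarShift p r := by
  obtain ⟨c, hc, h1, h2⟩ := h
  obtain ⟨d, hd, h3, h4⟩ := h'
  refine ⟨c * d, mul_ne_zero hc hd, ?_, ?_⟩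
  · rw [h3, h1, scaleRoots_mul]
  · rw [h4, h2, scaleRoots_mul]

theorem IsScalarShift.swap {p q : ℤ[X] × ℤ[X]} (h : IsScalarShift p q) :
    IsScalarShift p.swap q.swap := by
  obtain ⟨c, hc, h1, h2⟩ := h
  exact ⟨c, hc, h2, h1⟩

instance shiftSetoid : Setoid AdmissiblePair where
  r p q := ShiftEquiv p.1 q.1
  iseqv :=
    { refl := fun p => Or.inl (IsScalarShift.refl p.1)
      symm := by
        intro p q h
        rcases h with h | h
        · exact Or.inl h.symm
        · exact Or.inr (by simpa using h.symm.swap)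
      trans := by
        intro p q r h h'
        rcases h with h | h <;> rcases h' with h' | h'
        · exact Or.inl (h.trans h')
        · exact Or.inr (h.swap.trans h')
        · exact Or.inr (h.trans h')
        · exact Or.inl (by simpa using h.swap.trans h') }

/-- Admissible pairs up to scalar shift. -/
abbrev ShiftClass : Type := Quotient shiftSetoid

/-! ### The hypergeometric group -/

/-- The companion matrix of `f`: it maps `e₁ ↦ e₂ ↦ ⋯ ↦ e₅`, and its last column consists of the
negatives of the coefficients of `1, X, …, X⁴` in `f`. -/
def companionMatrix (f : ℤ[X]) : Matrix (Fin 5) (Fin 5) ℤ :=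
  Matrix.of fun i j =>
    if j = Fin.last 4 then -f.coeff i else if (i : ℕ) = (j : ℕ) + 1 then 1 else 0

/-- The hypergeometric group `Γ(f, g)`, generated by the companion matrices of `f` and `g`. (These
are invertible over `ℤ` when `f` and `g` have constant terms `±1`.) -/
def hypergeometricGroup (p : ℤ[X] × ℤ[X]) : Subgroup (GL (Fin 5) ℤ) :=
  Subgroup.closure {γ | (γ : Matrix (Fin 5) (Fin 5) ℤ) = companionMatrix p.1 ∨
    (γ : Matrix (Fin 5) (Fin 5) ℤ) = companionMatrix p.2}

/-- The action of an integral matrix on `K⁵`. -/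
def actOn (K : Type*) [Field K] (γ : GL (Fin 5) ℤ) : (Fin 5 → K) →ₗ[K] (Fin 5 → K) :=
  Matrix.toLin' ((γ : Matrix (Fin 5) (Fin 5) ℤ).map (Int.cast : ℤ → K))

/-- `(f, g)` is a primitive pair: `Γ(f, g)` acts irreducibly on `ℂ⁵`, and `ℂ⁵` is not the direct
sum of two or more nonzero subspaces which are permuted by `Γ(f, g)`. -/
def IsPrimitivePair (p : ℤ[X] × ℤ[X]) : Prop :=
  (∀ U : Submodule ℂ (Fin 5 → ℂ),
    (∀ γ ∈ hypergeometricGroup p, U.map (actOn ℂ γ) ≤ U) → U = ⊥ ∨ U = ⊤) ∧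
  ¬ ∃ (k : ℕ) (W : Fin k → Submodule ℂ (Fin 5 → ℂ)), 2 ≤ k ∧ (∀ i, W i ≠ ⊥) ∧
    DirectSum.IsInternal W ∧
    ∀ γ ∈ hypergeometricGroup p, ∀ i, ∃ j, (W i).map (actOn ℂ γ) = W j

/-- `f(X) = f₁(X^k)` and `g(X) = g₁(X^k)` for some integral `f₁`, `g₁` and some `k ≥ 2`. -/
def IsPolynomialInPower (p : ℤ[X] × ℤ[X]) : Prop :=
  ∃ (k : ℕ) (f₁ g₁ : ℤ[X]), 2 ≤ k ∧ p.1 = f₁.comp (X ^ k) ∧ p.2 = g₁.comp (X ^ k)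

/-! ### Interlacing roots and the invariant quadratic form -/

/-- `f = ∏ⱼ (X - exp(2πi αⱼ))`. -/
def HasParameters (f : ℤ[X]) (α : Fin 5 → ℚ) : Prop :=
  f.map (Int.castRingHom ℂ) =
    ∏ j, (X - C (Complex.exp (2 * Real.pi * Complex.I * ((α j : ℚ) : ℂ))))

/-- `α₁ < β₁ < α₂ < β₂ < ⋯ < α₅ < β₅`. -/
def Alternate (α β : Fin 5 → ℚ) : Prop :=
  (∀ j, α j < β j) ∧ ∀ j : Fin 4, β j.castSucc < α j.succ

/-- The roots of `f` and `g` interlace on the unit circle. -/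
def RootsInterlace (p : ℤ[X] × ℤ[X]) : Prop :=
  ∃ α β : Fin 5 → ℚ, (∀ j, α j ∈ Set.Ico 0 1) ∧ (∀ j, β j ∈ Set.Ico 0 1) ∧
    HasParameters p.1 α ∧ HasParameters p.2 β ∧ (Alternate α β ∨ Alternate β α)

/-- `Q` is preserved by the hypergeometric group of `p`. -/
def IsInvariantForm (p : ℤ[X] × ℤ[X]) (Q : QuadraticForm ℚ (Fin 5 → ℚ)) : Prop :=
  ∀ γ ∈ hypergeometricGroup p, ∀ x, Q (actOn ℚ γ x) = Q x

/-- The quadratic form on `ℚ⁵` preserved by the hypergeometric group, which is required to be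
unique up to a scalar, has signature `(a, b)` after multiplication by a suitable scalar. For
`a + b = 5` this includes that the form is non-degenerate. -/
def HasSignature (p : ℤ[X] × ℤ[X]) (a b : ℕ) : Prop :=
  ∃ Q : QuadraticForm ℚ (Fin 5 → ℚ), IsInvariantForm p Q ∧
    (∀ Q', IsInvariantForm p Q' → ∃ c : ℚ, Q' = c • Q) ∧ sigPos Q = a ∧ sigNeg Q = b

/-! ### The tables

A row `([d₁, …, d_r], [e₁, …, e_s])` stands for `f = Φ_{d₁} ⋯ Φ_{d_r}`, `g = Φ_{e₁} ⋯ Φ_{e_s}`. In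
terms of parameters, the index `d` contributes the fractions `k / d` with `0 ≤ k < d` prime
to `d`. -/

def cycloProd (l : List ℕ) : ℤ[X] := (l.map fun d => cyclotomic d ℤ).prod

def rowPair (t : List ℕ × List ℕ) : ℤ[X] × ℤ[X] := (cycloProd t.1, cycloProd t.2)

/-- `p` is, up to scalar shift, a row of the table `T`. -/
def IsListed (T : List (List ℕ × List ℕ)) (p : ℤ[X] × ℤ[X]) : Prop :=
  ∃ t ∈ T, ShiftEquiv (rowPair t) p

/-- The 4 pairs with interlacing roots. -/
def interlacingTable : List (List ℕ × List ℕ) :=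
  [([1, 3, 4], [2, 10]), ([1, 3, 6], [2, 10]), ([1, 5], [2, 10]),
   ([1, 8], [2, 10])]

/-- The 17 pairs with a quadratic form of signature `(4, 1)`. -/
def realRankOneTable : List (List ℕ × List ℕ) :=
  [([1, 1, 1, 3], [2, 8]), ([1, 1, 1, 3], [2, 12]), ([1, 1, 1, 4], [2, 10]),
   ([1, 1, 1, 6], [2, 10]), ([1, 3, 6], [2, 5]), ([1, 10], [2, 3, 4]),
   ([1, 10], [2, 8]), ([1, 1, 1, 3], [2, 2, 2, 4]), ([1, 1, 1, 3], [2, 2, 2, 6]),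
   ([1, 1, 1, 3], [2, 5]), ([1, 1, 1, 4], [2, 3, 6]), ([1, 1, 1, 4], [2, 5]),
   ([1, 1, 1, 4], [2, 8]), ([1, 1, 1, 4], [2, 12]), ([1, 1, 1, 6], [2, 8]),
   ([1, 1, 1, 6], [2, 12]), ([1, 10], [2, 5])]

/-- The 56 pairs with a quadratic form of signature `(3, 2)`. -/
def realRankTwoTable : List (List ℕ × List ℕ) :=
  [([1, 1, 1, 3], [2, 10]), ([1, 3, 3], [2, 4, 4]), ([1, 3, 3], [2, 5]),
   ([1, 3, 3], [2, 6, 6]), ([1, 3, 3], [2, 10]), ([1, 3, 3], [2, 12]),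
   ([1, 3, 4], [2, 5]), ([1, 5], [2, 4, 4]), ([1, 10], [2, 4, 4]),
   ([1, 12], [2, 4, 4]), ([1, 12], [2, 10]), ([1, 1, 1, 1, 1], [2, 4, 4]),
   ([1, 1, 1, 1, 1], [2, 6, 6]), ([1, 1, 1, 3], [2, 4, 4]), ([1, 1, 1, 3], [2, 4, 6]),
   ([1, 1, 1, 3], [2, 6, 6]), ([1, 1, 1, 4], [2, 6, 6]), ([1, 1, 1, 6], [2, 4, 4]),
   ([1, 3, 3], [2, 4, 6]), ([1, 3, 3], [2, 8]), ([1, 3, 4], [2, 8]),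
   ([1, 3, 4], [2, 12]), ([1, 3, 6], [2, 4, 4]), ([1, 3, 6], [2, 8]),
   ([1, 3, 6], [2, 12]), ([1, 5], [2, 3, 3]), ([1, 5], [2, 3, 4]),
   ([1, 6, 6], [2, 3, 3]), ([1, 6, 6], [2, 3, 4]), ([1, 6, 6], [2, 4, 4]),
   ([1, 8], [2, 3, 3]), ([1, 8], [2, 3, 4]), ([1, 8], [2, 4, 4]),
   ([1, 12], [2, 3, 4]), ([1, 12], [2, 5]), ([1, 12], [2, 8]),
   ([1, 1, 1, 1, 1], [2, 2, 2, 2, 2]), ([1, 1, 1, 1, 1], [2, 2, 2, 3]), ([1, 1, 1, 1, 1], [2, 2, 2, 4]),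
   ([1, 1, 1, 1, 1], [2, 2, 2, 6]), ([1, 1, 1, 1, 1], [2, 3, 3]), ([1, 1, 1, 1, 1], [2, 3, 4]),
   ([1, 1, 1, 1, 1], [2, 3, 6]), ([1, 1, 1, 1, 1], [2, 4, 6]), ([1, 1, 1, 1, 1], [2, 5]),
   ([1, 1, 1, 1, 1], [2, 8]), ([1, 1, 1, 1, 1], [2, 10]), ([1, 1, 1, 1, 1], [2, 12]),
   ([1, 1, 1, 4], [2, 2, 2, 3]), ([1, 1, 1, 4], [2, 3, 3]), ([1, 1, 1, 6], [2, 2, 2, 3]),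
   ([1, 1, 1, 6], [2, 3, 3]), ([1, 1, 1, 6], [2, 3, 4]), ([1, 1, 1, 6], [2, 5]),
   ([1, 10], [2, 3, 3]), ([1, 12], [2, 3, 3])]

end

/-!
The classification reduces to a finite grid. By the degree and the constant terms, `X - 1` divides
`f` and `X + 1` divides `g` with odd multiplicity, and the indices of the other cyclotomic factors
have totient at most four. This leaves fourteen polynomials for `f` and, as `f(X) ↦ -f(-X)`
exchanges the two normalizations, the fourteen corresponding ones for `g`; in row `i` they are
`(X - 1)(X⁴ + aX³ + bX² + aX + 1)` and `(X + 1)(X⁴ - aX³ + bX² - aX + 1)` with `a = tailA i`,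
`b = tailB i`. Comparing coefficients shows that only the scalar shifts by `±1` relate two points of
the grid, so a shift class is an unordered pair of rows without common root
(`IsAdmissible.exists_gridPair`, `shiftEquiv_gridPair_iff`).

Let `A`, `B` be the companion matrices. Then `Ax - Bx = x₅ w` with `w = g(A)e₁`, and `w` is a cyclic
vector for `A` because `f` and `g` are coprime. Hence `A` and `B` have no common invariant subspace
(`IsLinearPair.eq_bot_or_eq_top`), and an invariant bilinear form `β` is determined by `β(e₁, w)`,
since `β(eᵢ, w) = 0` for `i > 1` (`IsLinearPair.bilinForm_eq_zero`). So the invariant quadratic form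
is unique up to scalars. It exists: `gramRow` gives a Toeplitz matrix whose entries are
polynomials in the coefficients of `f` and `g`. Its signature is read off an explicit orthogonal
family of vectors (`exists_orthVal`). If the form is definite, then the group is finite, as its
elements have columns of bounded length in a lattice; if it is indefinite, then the group is
infinite, as a finite group also preserves a definite form (`finite_of_posDef`,
`infinite_of_indefinite`).

The arguments of the roots are multiples of 1/120 of a full turn and are determined up to order by
the polynomial. Interlacing thus becomes a statement on natural numbers below 120
(`rootsInterlace_gridPair_iff`).

For primitivity, the dimension five being prime, a system of imprimitivity consists of five lines,
which `A` and `B` permute. As `A - B` has rank one, the two permutations differ at most by a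
transposition; since they generate a transitive group, one of them is a full cycle and the other has
at most two cycles (`cycles_of_transitive`). A full cycle makes the polynomial `X⁵ ± 1`, and two
cycles make it `(X - t)(X⁴ - r)` or `(X² - t)(X³ - r)`. Among the fourteen rows this leaves the
three exceptional classes, and for each of these five lines permuted by the group are exhibited
(`isPrimitivePair_of_not_inTable`, `not_isPrimitivePair_of_inTable`).
-/


/-! ### Admissible pairs in terms of lists of indices -/

/-- The lists `[d₁, …, d_r]` for which `Φ_{d₁} ⋯ Φ_{d_r}` can be the first member of an admissible
pair. -/
def fRow : Fin 14 → List ℕ :=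
  ![[1, 5], [1, 8], [1, 10], [1, 12], [1, 3, 3], [1, 3, 4], [1, 3, 6], [1, 4, 4], [1, 4, 6],
    [1, 6, 6], [1, 1, 1, 3], [1, 1, 1, 4], [1, 1, 1, 6], [1, 1, 1, 1, 1]]

/-- The lists for the second members. The roots of `Φ_d`, `d ∈ gRow i`, are the negatives of the
roots of `Φ_d`, `d ∈ fRow i`. -/
def gRow : Fin 14 → List ℕ :=
  ![[2, 10], [2, 8], [2, 5], [2, 12], [2, 6, 6], [2, 4, 6], [2, 3, 6], [2, 4, 4], [2, 3, 4],
    [2, 3, 3], [2, 2, 2, 6], [2, 2, 2, 4], [2, 2, 2, 3], [2, 2, 2, 2, 2]]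

/-- The prime powers with totient at most five divide `8`, `3` or `5`. -/
theorem dvd_of_totient_le_five {d : ℕ} (h0 : 0 < d) (h : d.totient ≤ 5) :
    d ∣ 120 := by
  rw [Nat.dvd_iff_prime_pow_dvd_dvd]
  intro p k hp hk
  have hle : (p ^ k).totient ≤ 5 :=
    (Nat.le_of_dvd (Nat.totient_pos.2 h0) (Nat.totient_dvd_of_dvd hk)).trans h
  rcases Nat.eq_zero_or_pos k with rfl | hk0
  · simp
  rw [Nat.totient_prime_pow hp hk0] at hle
  have hp6 : p ≤ 6 := by
    have : 1 * (p - 1) ≤ p ^ (k - 1) * (p - 1) := Nat.mul_le_mul_right _ (Nat.pow_pos hp.pos)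
    omega
  have hp2 := hp.two_le
  have hk4 : k ≤ 3 := by
    by_contra hk4
    have h1 : 2 ^ 3 ≤ p ^ (k - 1) :=
      (Nat.pow_le_pow_left hp2 3).trans (Nat.pow_le_pow_right hp.pos (by omega))
    have : 2 ^ 3 * 1 ≤ p ^ (k - 1) * (p - 1) := Nat.mul_le_mul h1 (by omega)
    omega
  interval_cases p
  all_goals first
    | (revert hp; norm_num; done)
    | (interval_cases k <;> revert hle <;> norm_num)

theorem mem_of_totient_le_five {d : ℕ} (h0 : 0 < d) (h : d.totient ≤ 5) :
    d ∈ ({1, 2, 3, 4, 5, 6, 8, 10, 12} : Finset ℕ) := by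
  have hd : d ∈ Nat.divisors 120 := by simpa using dvd_of_totient_le_five h0 h
  have key : ∀ e ∈ Nat.divisors 120, e.totient ≤ 5 →
      e ∈ ({1, 2, 3, 4, 5, 6, 8, 10, 12} : Finset ℕ) := by decide +kernel
  exact key d hd h

theorem natDegree_cyclotomicProd (s : Multiset ℕ) :
    ((s.map fun d => cyclotomic d ℤ).prod).natDegree = (s.map Nat.totient).sum := by
  rw [natDegree_multiset_prod_of_monic _ (by
    intro q hq
    obtain ⟨d, -, rfl⟩ := Multiset.mem_map.1 hq
    exact cyclotomic.monic d ℤ)]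
  simp [natDegree_cyclotomic]

theorem eval_zero_cyclotomicProd (s : Multiset ℕ) (hs : ∀ d ∈ s, 0 < d) :
    ((s.map fun d => cyclotomic d ℤ).prod).eval 0 = (-1) ^ s.count 1 := by
  induction s using Multiset.induction_on with
  | empty => simp
  | cons d s ih =>
    have ih := ih fun e he => hs e (Multiset.mem_cons_of_mem he)
    have hd := hs d (Multiset.mem_cons_self d s)
    rw [Multiset.map_cons, Multiset.prod_cons, eval_mul, ih]
    rcases eq_or_ne d 1 with rfl | h1
    · simp [pow_succ]
    · rw [← coeff_zero_eq_eval_zero, cyclotomic_coeff_zero ℤ (by omega),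
        Multiset.count_cons_of_ne h1.symm, one_mul]

theorem aeval_cyclotomicProd_eq_zero_iff (s : Multiset ℕ) (hs : ∀ d ∈ s, 0 < d) (z : ℂ) :
    aeval z ((s.map fun d => cyclotomic d ℤ).prod) = 0 ↔ ∃ d ∈ s, IsPrimitiveRoot z d := by
  induction s using Multiset.induction_on with
  | empty => simp
  | cons d s ih =>
    have ih := ih fun e he => hs e (Multiset.mem_cons_of_mem he)
    have hd := hs d (Multiset.mem_cons_self d s)
    have : NeZero (d : ℂ) := ⟨by exact_mod_cast hd.ne'⟩
    rw [Multiset.map_cons, Multiset.prod_cons, map_mul, mul_eq_zero, ih, ← eval_map_algebraMap,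
      map_cyclotomic, ← IsRoot.def, isRoot_cyclotomic_iff]
    simp

theorem no_common_root_iff (s t : Multiset ℕ) (hs : ∀ d ∈ s, 0 < d) (ht : ∀ d ∈ t, 0 < d) :
    (∀ z : ℂ, ¬ (aeval z ((s.map fun d => cyclotomic d ℤ).prod) = 0 ∧
      aeval z ((t.map fun d => cyclotomic d ℤ).prod) = 0)) ↔ ∀ d ∈ s, d ∉ t := by
  simp only [aeval_cyclotomicProd_eq_zero_iff s hs, aeval_cyclotomicProd_eq_zero_iff t ht]
  constructor
  · intro h d hd hd'
    have := Complex.isPrimitiveRoot_exp d (hs d hd).ne'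
    exact h _ ⟨⟨d, hd, this⟩, ⟨d, hd', this⟩⟩
  · rintro h z ⟨⟨d, hd, h1⟩, ⟨e, he, h2⟩⟩
    rw [h1.unique h2] at hd
    exact h e hd he

theorem totient_sum_eq (s : Multiset ℕ) (hs : ∀ d ∈ s, 0 < d) (h : (s.map Nat.totient).sum = 5) :
    (∀ d ∈ s, d ∈ ({1, 2, 3, 4, 5, 6, 8, 10, 12} : Finset ℕ)) ∧
    s.count 1 + s.count 2 + 2 * (s.count 3 + s.count 4 + s.count 6) +
      4 * (s.count 5 + s.count 8 + s.count 10 + s.count 12) = 5 := by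
  have hmem : ∀ d ∈ s, d ∈ ({1, 2, 3, 4, 5, 6, 8, 10, 12} : Finset ℕ) := fun d hd =>
    mem_of_totient_le_five (hs d hd)
      (h ▸ Multiset.single_le_sum (fun _ _ => Nat.zero_le _) _ (Multiset.mem_map_of_mem _ hd))
  refine ⟨hmem, ?_⟩
  rw [Finset.sum_multiset_map_count, Finset.sum_subset (s₂ := {1, 2, 3, 4, 5, 6, 8, 10, 12})
    (fun d hd => hmem d (Multiset.mem_toFinset.1 hd))
    (fun d _ hd => by
      rw [Multiset.mem_toFinset] at hd
      simp [Multiset.count_eq_zero_of_notMem hd])] at h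
  have : Nat.totient 3 = 2 ∧ Nat.totient 4 = 2 ∧ Nat.totient 5 = 4 ∧ Nat.totient 6 = 2 ∧
    Nat.totient 8 = 4 ∧ Nat.totient 10 = 4 ∧ Nat.totient 12 = 4 := by decide
  simp [this] at h
  omega

theorem eq_of_count_eq (s t : Multiset ℕ)
    (hs : ∀ d ∈ s, d ∈ ({1, 2, 3, 4, 5, 6, 8, 10, 12} : Finset ℕ))
    (ht : ∀ d ∈ t, d ∈ ({1, 2, 3, 4, 5, 6, 8, 10, 12} : Finset ℕ))
    (h : ∀ d ∈ ({1, 2, 3, 4, 5, 6, 8, 10, 12} : Finset ℕ), s.count d = t.count d) : s = t := by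
  ext d
  by_cases hd : d ∈ ({1, 2, 3, 4, 5, 6, 8, 10, 12} : Finset ℕ)
  · exact h d hd
  · rw [Multiset.count_eq_zero_of_notMem fun h => hd (hs d h),
      Multiset.count_eq_zero_of_notMem fun h => hd (ht d h)]

/-- The rows of the grid are all solutions of the degree equation; multiplicities are listed in the
order `1, 3, 4, 6, 5, 8, 10, 12`. -/
theorem exists_count_fRow : ∀ (n1 : Fin 6) (n3 n4 n6 : Fin 3) (n5 n8 n10 n12 : Fin 2),
    n1.1 % 2 = 1 → n1.1 + 2 * (n3.1 + n4.1 + n6.1) + 4 * (n5.1 + n8.1 + n10.1 + n12.1) = 5 →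
    ∃ i, [1, 3, 4, 6, 5, 8, 10, 12].map (fun d => (fRow i).count d) =
      [n1.1, n3.1, n4.1, n6.1, n5.1, n8.1, n10.1, n12.1] := by
  decide +kernel

theorem exists_count_gRow : ∀ (n2 : Fin 6) (n3 n4 n6 : Fin 3) (n5 n8 n10 n12 : Fin 2),
    n2.1 % 2 = 1 → n2.1 + 2 * (n3.1 + n4.1 + n6.1) + 4 * (n5.1 + n8.1 + n10.1 + n12.1) = 5 →
    ∃ i, [2, 3, 4, 6, 5, 8, 10, 12].map (fun d => (gRow i).count d) =
      [n2.1, n3.1, n4.1, n6.1, n5.1, n8.1, n10.1, n12.1] := by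
  decide +kernel

/-- The pair `(Φ_{d₁} ⋯ Φ_{d_r}, Φ_{e₁} ⋯ Φ_{e_s})` for `d = fRow i`, `e = gRow j`. -/
noncomputable def gridPair (i j : Fin 14) : ℤ[X] × ℤ[X] := rowPair (fRow i, gRow j)

/-- The two members of `gridPair i j` have no common root. -/
abbrev GridCoprime (i j : Fin 14) : Prop := ∀ d ∈ fRow i, d ∉ gRow j

theorem cycloProd_eq_multiset (l : List ℕ) :
    cycloProd l = ((l : Multiset ℕ).map fun d => cyclotomic d ℤ).prod := by
  simp [cycloProd]

theorem natDegree_cycloProd (l : List ℕ) :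
    (cycloProd l).natDegree = ((l : Multiset ℕ).map Nat.totient).sum := by
  rw [cycloProd_eq_multiset, natDegree_cyclotomicProd]

theorem eval_zero_cycloProd (l : List ℕ) (hl : ∀ d ∈ l, 0 < d) :
    (cycloProd l).eval 0 = (-1) ^ l.count 1 := by
  rw [cycloProd_eq_multiset, eval_zero_cyclotomicProd _ hl, Multiset.coe_count]

theorem fRow_pos (i : Fin 14) : ∀ d ∈ fRow i, 0 < d := by revert i; decide

theorem gRow_pos (i : Fin 14) : ∀ d ∈ gRow i, 0 < d := by revert i; decide

theorem isAdmissible_gridPair {i j : Fin 14} (h : GridCoprime i j) :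
    IsAdmissible (gridPair i j) where
  cyclotomic_fst := ⟨fRow i, fRow_pos i, cycloProd_eq_multiset _⟩
  cyclotomic_snd := ⟨gRow j, gRow_pos j, cycloProd_eq_multiset _⟩
  natDegree_fst := by
    have : ∀ i, ((fRow i : Multiset ℕ).map Nat.totient).sum = 5 := by decide
    exact (natDegree_cycloProd _).trans (this i)
  natDegree_snd := by
    have : ∀ i, ((gRow i : Multiset ℕ).map Nat.totient).sum = 5 := by decide
    exact (natDegree_cycloProd _).trans (this j)
  no_common_root := by
    rw [gridPair, rowPair, cycloProd_eq_multiset, cycloProd_eq_multiset,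
      no_common_root_iff _ _ (fRow_pos i) (gRow_pos j)]
    exact h
  eval_fst := by
    have : ∀ i, (-1 : ℤ) ^ (fRow i).count 1 = -1 := by decide
    exact (eval_zero_cycloProd _ (fRow_pos i)).trans (this i)
  eval_snd := by
    have : ∀ i, (-1 : ℤ) ^ (gRow i).count 1 = 1 := by decide
    exact (eval_zero_cycloProd _ (gRow_pos j)).trans (this j)

/-- Every admissible pair is one of the pairs `gridPair i j`. By `f(0) = -1`, `g(0) = 1` and the
degree, `Φ₁` divides `f` and `Φ₂` divides `g` with odd multiplicity, which leaves fourteen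
possibilities for each of the two. -/
theorem IsAdmissible.exists_gridPair {p : ℤ[X] × ℤ[X]} (hp : IsAdmissible p) :
    ∃ i j, GridCoprime i j ∧ p = gridPair i j := by
  obtain ⟨f, g⟩ := p
  obtain ⟨⟨s, hs, hf⟩, ⟨t, ht, hg⟩, hdf, hdg, hno, hef, heg⟩ := hp
  simp only at hf hg hdf hdg hno hef heg
  subst hf hg
  rw [natDegree_cyclotomicProd] at hdf hdg
  rw [eval_zero_cyclotomicProd _ hs] at hef
  rw [eval_zero_cyclotomicProd _ ht] at heg
  rw [no_common_root_iff _ _ hs ht] at hno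
  obtain ⟨hms, hcs⟩ := totient_sum_eq s hs hdf
  obtain ⟨hmt, hct⟩ := totient_sum_eq t ht hdg
  have hs1 : Odd (s.count 1) := by
    by_contra h
    rw [Nat.not_odd_iff_even] at h
    norm_num [h.neg_one_pow] at hef
  have ht1 : Even (t.count 1) := by
    by_contra h
    rw [Nat.not_even_iff_odd] at h
    norm_num [h.neg_one_pow] at heg
  rw [Nat.odd_iff] at hs1
  rw [Nat.even_iff] at ht1
  have hs2 : s.count 2 = 0 := Multiset.count_eq_zero_of_notMem fun h2 =>
    hno 2 h2 (Multiset.count_pos.1 (by omega))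
  have ht2 : t.count 1 = 0 := Multiset.count_eq_zero_of_notMem
    (hno 1 (Multiset.count_pos.1 (by omega)))
  obtain ⟨i, hi⟩ := exists_count_fRow ⟨s.count 1, by omega⟩ ⟨s.count 3, by omega⟩
    ⟨s.count 4, by omega⟩ ⟨s.count 6, by omega⟩ ⟨s.count 5, by omega⟩ ⟨s.count 8, by omega⟩
    ⟨s.count 10, by omega⟩ ⟨s.count 12, by omega⟩ hs1 (by simp only; omega)
  obtain ⟨j, hj⟩ := exists_count_gRow ⟨t.count 2, by omega⟩ ⟨t.count 3, by omega⟩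
    ⟨t.count 4, by omega⟩ ⟨t.count 6, by omega⟩ ⟨t.count 5, by omega⟩ ⟨t.count 8, by omega⟩
    ⟨t.count 10, by omega⟩ ⟨t.count 12, by omega⟩ (by simp only; omega) (by simp only; omega)
  simp only [List.map_cons, List.map_nil, List.cons.injEq, and_true] at hi hj
  have hsi : s = fRow i := by
    refine eq_of_count_eq _ _ hms (by clear hi hj; revert i; decide) ?_
    have h2 : (fRow i).count 2 = 0 := by clear hi hj; revert i; decide
    simp [hi, hs2, h2]
  have htj : t = gRow j := by
    refine eq_of_count_eq _ _ hmt (by clear hi hj; revert j; decide) ?_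
    have h2 : (gRow j).count 1 = 0 := by clear hi hj; revert j; decide
    simp [hj, ht2, h2]
  subst hsi htj
  exact ⟨i, j, hno, by simp [gridPair, rowPair, cycloProd]⟩

/-! ### Explicit coefficients -/

/-- `(X - 1)(X⁴ + aX³ + bX² + aX + 1)`. -/
noncomputable def fPoly (a b : ℤ) : ℤ[X] :=
  X ^ 5 + C (a - 1) * X ^ 4 + C (b - a) * X ^ 3 + C (a - b) * X ^ 2 + C (1 - a) * X - 1

/-- `(X + 1)(X⁴ - aX³ + bX² - aX + 1)`, whose roots are the negatives of those of `fPoly a b`. -/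
noncomputable def gPoly (a b : ℤ) : ℤ[X] :=
  X ^ 5 + C (1 - a) * X ^ 4 + C (b - a) * X ^ 3 + C (b - a) * X ^ 2 + C (1 - a) * X + 1

/-- The coefficient `a` of the polynomial `fPoly a b` with indices `fRow i`. -/
def tailA : Fin 14 → ℤ := ![1, 0, -1, 0, 2, 1, 0, 0, -1, -2, -1, -2, -3, -4]

/-- The coefficient `b` of the polynomial `fPoly a b` with indices `fRow i`. -/
def tailB : Fin 14 → ℤ := ![1, 0, 1, -1, 3, 2, 1, 2, 2, 3, 0, 2, 4, 6]

theorem cyclotomic_four_int : cyclotomic 4 ℤ = X ^ 2 + 1 := by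
  rw [show 4 = 2 * 2 by rfl, ← cyclotomic_expand_eq_cyclotomic Nat.prime_two dvd_rfl,
    cyclotomic_two]
  simp

theorem cyclotomic_five_int : cyclotomic 5 ℤ = X ^ 4 + X ^ 3 + X ^ 2 + X + 1 := by
  have : Fact (Nat.Prime 5) := ⟨by norm_num⟩
  rw [cyclotomic_prime]
  simp only [Finset.sum_range_succ, Finset.sum_range_zero]
  ring

theorem cyclotomic_eight_int : cyclotomic 8 ℤ = X ^ 4 + 1 := by
  rw [show 8 = 4 * 2 by rfl, ← cyclotomic_expand_eq_cyclotomic Nat.prime_two (by norm_num),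
    cyclotomic_four_int]
  simp [← pow_mul]

theorem cyclotomic_twelve_int : cyclotomic 12 ℤ = X ^ 4 - X ^ 2 + 1 := by
  rw [show 12 = 6 * 2 by rfl, ← cyclotomic_expand_eq_cyclotomic Nat.prime_two (by norm_num),
    cyclotomic_six]
  simp [← pow_mul]

theorem cyclotomic_ten_int : cyclotomic 10 ℤ = X ^ 4 - X ^ 3 + X ^ 2 - X + 1 := by
  have h := cyclotomic_expand_eq_cyclotomic_mul (p := 2) (n := 5) Nat.prime_two (by norm_num) ℤ
  rw [show 5 * 2 = 10 by rfl] at h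
  refine mul_right_cancel₀ (cyclotomic_ne_zero 5 ℤ) ?_
  rw [← h, cyclotomic_five_int]
  simp
  ring

theorem cycloProd_fRow (i : Fin 14) : cycloProd (fRow i) = fPoly (tailA i) (tailB i) := by
  fin_cases i <;>
    simp [cycloProd, fRow, fPoly, tailA, tailB, cyclotomic_three, cyclotomic_six,
      cyclotomic_four_int, cyclotomic_five_int, cyclotomic_eight_int, cyclotomic_ten_int,
      cyclotomic_twelve_int] <;> ring

theorem cycloProd_gRow (i : Fin 14) : cycloProd (gRow i) = gPoly (tailA i) (tailB i) := by
  fin_cases i <;>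
    simp [cycloProd, gRow, gPoly, tailA, tailB, cyclotomic_three, cyclotomic_six,
      cyclotomic_four_int, cyclotomic_five_int, cyclotomic_eight_int, cyclotomic_ten_int,
      cyclotomic_twelve_int] <;> ring

theorem gridPair_eq (i j : Fin 14) :
    gridPair i j = (fPoly (tailA i) (tailB i), gPoly (tailA j) (tailB j)) := by
  rw [gridPair, rowPair, cycloProd_fRow, cycloProd_gRow]

theorem tail_injective {i j : Fin 14} (ha : tailA i = tailA j) (hb : tailB i = tailB j) :
    i = j := by
  revert i j; decide

theorem fPoly_coeff (a b : ℤ) :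
    (fPoly a b).coeff 0 = -1 ∧ (fPoly a b).coeff 1 = 1 - a ∧ (fPoly a b).coeff 2 = a - b ∧
    (fPoly a b).coeff 3 = b - a ∧ (fPoly a b).coeff 4 = a - 1 ∧ (fPoly a b).coeff 5 = 1 := by
  simp [fPoly, coeff_X, coeff_one, coeff_X_pow, -map_sub, -eq_intCast]

theorem gPoly_coeff (a b : ℤ) :
    (gPoly a b).coeff 0 = 1 ∧ (gPoly a b).coeff 1 = 1 - a ∧ (gPoly a b).coeff 2 = b - a ∧
    (gPoly a b).coeff 3 = b - a ∧ (gPoly a b).coeff 4 = 1 - a ∧ (gPoly a b).coeff 5 = 1 := by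
  simp [gPoly, coeff_X, coeff_one, coeff_X_pow, -map_sub, -eq_intCast]

theorem natDegree_fPoly (a b : ℤ) : (fPoly a b).natDegree = 5 := by
  unfold fPoly; compute_degree!

theorem natDegree_gPoly (a b : ℤ) : (gPoly a b).natDegree = 5 := by
  unfold gPoly; compute_degree!

/-! ### Scalar shifts in coordinates -/

theorem natDegree_map_complex (p : ℤ[X]) :
    (p.map (Int.castRingHom ℂ)).natDegree = p.natDegree :=
  natDegree_map_eq_of_injective Int.cast_injective p

theorem gPoly_map (a b : ℤ) : (gPoly a b).map (Int.castRingHom ℂ) =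
    ((fPoly a b).map (Int.castRingHom ℂ)).scaleRoots (-1) := by
  obtain ⟨f0, f1, f2, f3, f4, f5⟩ := fPoly_coeff a b
  obtain ⟨g0, g1, g2, g3, g4, g5⟩ := gPoly_coeff a b
  ext n
  rw [coeff_scaleRoots, natDegree_map_complex, natDegree_fPoly, coeff_map, coeff_map]
  rcases lt_or_ge 5 n with h | h
  · rw [coeff_eq_zero_of_natDegree_lt (by rwa [natDegree_gPoly]),
      coeff_eq_zero_of_natDegree_lt (by rwa [natDegree_fPoly])]
    simp
  · interval_cases n <;> simp [*] <;> norm_num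

/-- The constant coefficient forces `c⁵ = 1`; and as the coefficients of `X` and `X⁴`, as well as
those of `X²` and `X³`, agree up to sign, `c³ = 1` or `c = 1` unless all of them vanish. -/
theorem eq_of_scaleRoots_fPoly {a b a' b' : ℤ} {c : ℂ}
    (h : (fPoly a' b').map (Int.castRingHom ℂ) =
      ((fPoly a b).map (Int.castRingHom ℂ)).scaleRoots c) : a' = a ∧ b' = b := by
  obtain ⟨f0, f1, f2, f3, f4, f5⟩ := fPoly_coeff a b
  obtain ⟨g0, g1, g2, g3, g4, g5⟩ := fPoly_coeff a' b'
  have key : ∀ n ≤ 5, ((fPoly a' b').coeff n : ℂ) = ((fPoly a b).coeff n : ℂ) * c ^ (5 - n) := by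
    intro n _
    have := congrArg (fun p => coeff p n) h
    simpa [coeff_scaleRoots, natDegree_map_complex, natDegree_fPoly] using this
  have h0 := key 0 (by norm_num)
  have h1 := key 1 (by norm_num)
  have h2 := key 2 (by norm_num)
  have h3 := key 3 (by norm_num)
  have h4 := key 4 (by norm_num)
  simp only [f0, f1, f2, f3, f4, g0, g1, g2, g3, g4] at h0 h1 h2 h3 h4
  push_cast at h0 h1 h2 h3 h4
  norm_num at h0 h1 h2 h3 h4
  have e1 : ((a : ℂ) - 1) * (c - c ^ 4) = 0 := by linear_combination -h1 - h4
  have e2 : ((b : ℂ) - a) * (c ^ 2 - c ^ 3) = 0 := by linear_combination -h2 - h3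
  have hc0 : c ≠ 0 := by rintro rfl; norm_num at h0
  have h5 : c ^ 5 = 1 := by linear_combination -h0
  rcases mul_eq_zero.1 e1 with ha | hc
  · rcases mul_eq_zero.1 e2 with hb | hc
    · rw [ha] at h4
      rw [hb] at h3
      have ha' : (a' : ℂ) = a := by linear_combination h4 - ha
      have hb' : (b' : ℂ) = b := by linear_combination h3 + ha' - hb
      exact ⟨by exact_mod_cast ha', by exact_mod_cast hb'⟩
    · have hc1 : c = 1 := by
        have : c ^ 2 * (1 - c) = 0 := by linear_combination hc
        rcases mul_eq_zero.1 this with h | h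
        · exact absurd (pow_eq_zero_iff (two_ne_zero) |>.1 h) hc0
        · linear_combination -h
      subst hc1
      have ha' : (a' : ℂ) = a := by linear_combination h4
      have hb' : (b' : ℂ) = b := by linear_combination h3 + ha'
      exact ⟨by exact_mod_cast ha', by exact_mod_cast hb'⟩
  · have hc3 : c ^ 3 = 1 := by
      have : c * (1 - c ^ 3) = 0 := by linear_combination hc
      rcases mul_eq_zero.1 this with h | h
      · exact absurd h hc0
      · linear_combination -h
    have hc1 : c = 1 := by linear_combination (c ^ 3 + 1) * hc3 - c * h5
    subst hc1
    have ha' : (a' : ℂ) = a := by linear_combination h4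
    have hb' : (b' : ℂ) = b := by linear_combination h3 + ha'
    exact ⟨by exact_mod_cast ha', by exact_mod_cast hb'⟩

/-- Only the shifts by `1` and `-1` matter, and the latter exchanges the two rows. -/
theorem shiftEquiv_gridPair_iff (i j i' j' : Fin 14) :
    ShiftEquiv (gridPair i j) (gridPair i' j') ↔ (i' = i ∧ j' = j) ∨ (i' = j ∧ j' = i) := by
  constructor
  · rintro (⟨c, -, h1, h2⟩ | ⟨c, -, h1, h2⟩)
    · left
      simp only [gridPair_eq, gPoly_map] at h1 h2
      obtain ⟨ha, hb⟩ := eq_of_scaleRoots_fPoly h1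
      have h2' := congrArg (fun p => p.scaleRoots (-1 : ℂ)) h2
      simp only [← scaleRoots_mul, mul_neg, mul_one, neg_mul, one_mul, neg_neg,
        scaleRoots_one] at h2'
      obtain ⟨ha', hb'⟩ := eq_of_scaleRoots_fPoly h2'
      exact ⟨tail_injective ha hb, tail_injective ha' hb'⟩
    · right
      simp only [gridPair_eq, Prod.swap, gPoly_map] at h1 h2
      rw [← scaleRoots_mul] at h1
      obtain ⟨ha, hb⟩ := eq_of_scaleRoots_fPoly h1
      have h2' := congrArg (fun p => p.scaleRoots (-1 : ℂ)) h2
      simp only [← scaleRoots_mul, mul_neg, mul_one, neg_neg, scaleRoots_one] at h2'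
      obtain ⟨ha', hb'⟩ := eq_of_scaleRoots_fPoly h2'
      exact ⟨tail_injective ha hb, tail_injective ha' hb'⟩
  · rintro (⟨rfl, rfl⟩ | ⟨rfl, rfl⟩)
    · exact Or.inl (IsScalarShift.refl _)
    · refine Or.inr ⟨-1, by norm_num, ?_, ?_⟩
      · simp [gridPair_eq, gPoly_map, ← scaleRoots_mul]
      · simp [gridPair_eq, gPoly_map]

/-! ### The tables in terms of rows -/

/-- The pair `gridPair i j` or its shift by `-1` is a row of the table `T`. -/
abbrev InTable (T : List (List ℕ × List ℕ)) (i j : Fin 14) : Prop :=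
  (fRow i, gRow j) ∈ T ∨ (fRow j, gRow i) ∈ T

/-- All rows of `T` are of the form `(fRow i, gRow j)`. -/
abbrev IsGridTable (T : List (List ℕ × List ℕ)) : Prop :=
  ∀ t ∈ T, ∃ i j, t = (fRow i, gRow j) ∧ GridCoprime i j

theorem isListed_gridPair_iff {T : List (List ℕ × List ℕ)} (hT : IsGridTable T) (i j : Fin 14) :
    IsListed T (gridPair i j) ↔ InTable T i j := by
  constructor
  · rintro ⟨t, ht, h⟩
    obtain ⟨i', j', rfl, -⟩ := hT t ht
    rcases (shiftEquiv_gridPair_iff i' j' i j).1 h with ⟨rfl, rfl⟩ | ⟨rfl, rfl⟩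
    · exact Or.inl ht
    · exact Or.inr ht
  · rintro (h | h)
    · exact ⟨_, h, (shiftEquiv_gridPair_iff i j i j).2 (Or.inl ⟨rfl, rfl⟩)⟩
    · exact ⟨_, h, (shiftEquiv_gridPair_iff j i i j).2 (Or.inr ⟨rfl, rfl⟩)⟩

/-- The table of all pairs. -/
abbrev fullTable : List (List ℕ × List ℕ) :=
  interlacingTable ++ realRankOneTable ++ realRankTwoTable

theorem isGridTable_fullTable : IsGridTable fullTable := by decide +kernel

theorem nodup_fullTable : fullTable.Nodup := by decide +kernel

/-- Every admissible pair is listed, and only one of `(f, g)` and its shift by `-1` is a row. -/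
theorem inTable_fullTable : ∀ i j, GridCoprime i j → InTable fullTable i j ∧
    ((fRow i, gRow j) ∈ fullTable → (fRow j, gRow i) ∈ fullTable → i = j) := by
  decide +kernel

theorem existsUnique_listed {p : ℤ[X] × ℤ[X]} (hp : IsAdmissible p) :
    ∃! t, t ∈ fullTable ∧ ShiftEquiv (rowPair t) p := by
  obtain ⟨i, j, hij, rfl⟩ := hp.exists_gridPair
  obtain ⟨h1, h2⟩ := inTable_fullTable i j hij
  obtain ⟨t, ht, h⟩ := (isListed_gridPair_iff isGridTable_fullTable i j).2 h1
  refine ⟨t, ⟨ht, h⟩, ?_⟩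
  rintro t' ⟨ht', h'⟩
  obtain ⟨k, l, rfl, -⟩ := isGridTable_fullTable t ht
  obtain ⟨k', l', rfl, -⟩ := isGridTable_fullTable t' ht'
  rcases (shiftEquiv_gridPair_iff _ _ _ _).1 h with ⟨rfl, rfl⟩ | ⟨rfl, rfl⟩ <;>
    rcases (shiftEquiv_gridPair_iff _ _ _ _).1 h' with ⟨rfl, rfl⟩ | ⟨rfl, rfl⟩
  · rfl
  · rw [h2 ht ht']
  · rw [h2 ht' ht]
  · rfl

theorem isAdmissible_rowPair {t : List ℕ × List ℕ} (ht : t ∈ fullTable) :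
    IsAdmissible (rowPair t) := by
  obtain ⟨i, j, rfl, h⟩ := isGridTable_fullTable t ht
  exact isAdmissible_gridPair h

/-- The class of the `n`-th row of the table. -/
noncomputable def classOfRow (n : Fin fullTable.length) : ShiftClass :=
  ⟦⟨rowPair (fullTable.get n), isAdmissible_rowPair (List.get_mem _ _)⟩⟧

theorem classOfRow_eq_iff (n : Fin fullTable.length) (p : AdmissiblePair) :
    classOfRow n = ⟦p⟧ ↔ ShiftEquiv (rowPair (fullTable.get n)) p.1 :=
  Quotient.eq

theorem classOfRow_bijective : Function.Bijective classOfRow := by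
  constructor
  · intro m n h
    obtain ⟨t, -, hu⟩ := existsUnique_listed (isAdmissible_rowPair (List.get_mem fullTable n))
    have hm := hu _ ⟨List.get_mem _ m, (classOfRow_eq_iff m _).1 h⟩
    have hn := hu _ ⟨List.get_mem _ n, (classOfRow_eq_iff n _).1 rfl⟩
    exact (List.nodup_iff_injective_get.1 nodup_fullTable) (hm.trans hn.symm)
  · intro κ
    induction κ using Quotient.inductionOn with
    | h p =>
      obtain ⟨t, ⟨ht, h⟩, -⟩ := existsUnique_listed p.2
      obtain ⟨n, rfl⟩ := List.get_of_mem ht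
      exact ⟨n, (classOfRow_eq_iff n p).2 h⟩

theorem card_shiftClass : Nat.card ShiftClass = 77 := by
  rw [← Nat.card_congr (Equiv.ofBijective _ classOfRow_bijective), Nat.card_fin]
  decide

/-- A property of admissible pairs which holds precisely for the pairs listed in a subtable `T`
defines as many classes as `T` has rows. -/
theorem card_class_of_isListed {P : ℤ[X] × ℤ[X] → Prop} {T : List (List ℕ × List ℕ)}
    (hT : T ⊆ fullTable) (hnd : T.Nodup)
    (h : ∀ p, IsAdmissible p → (P p ↔ IsListed T p)) :
    Nat.card {κ : ShiftClass // ∀ p : AdmissiblePair, ⟦p⟧ = κ → P p.1} = T.length := by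
  have key : ∀ n, (∀ p : AdmissiblePair, ⟦p⟧ = classOfRow n → P p.1) ↔ fullTable.get n ∈ T := by
    intro n
    constructor
    · intro hn
      have hadm := isAdmissible_rowPair (List.get_mem fullTable n)
      obtain ⟨t, ht, hs⟩ := (h _ hadm).1 (hn ⟨_, hadm⟩ rfl)
      obtain ⟨t', -, hu⟩ := existsUnique_listed hadm
      have h1 := hu t ⟨hT ht, hs⟩
      have h2 := hu _ ⟨List.get_mem fullTable n, Or.inl (IsScalarShift.refl _)⟩
      rwa [h2, ← h1]
    · intro hn p hp
      exact (h _ p.2).2 ⟨_, hn, (classOfRow_eq_iff n p).1 hp.symm⟩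
  have e1 : {n // fullTable.get n ∈ T} ≃
      {κ : ShiftClass // ∀ p : AdmissiblePair, ⟦p⟧ = κ → P p.1} :=
    (Equiv.ofBijective _ classOfRow_bijective).subtypeEquiv fun n => (key n).symm
  have e2 : {n // fullTable.get n ∈ T} ≃ {t // t ∈ T} :=
    Equiv.ofBijective (fun n => ⟨fullTable.get n.1, n.2⟩) ⟨by
      intro m n hmn
      exact Subtype.ext ((List.nodup_iff_injective_get.1 nodup_fullTable)
        (congrArg Subtype.val hmn)), by
      rintro ⟨t, ht⟩
      obtain ⟨n, rfl⟩ := List.get_of_mem (hT ht)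
      exact ⟨⟨n, ht⟩, rfl⟩⟩
  have e3 : {t // t ∈ T} ≃ T.toFinset := Equiv.subtypeEquivRight fun t => by simp
  rw [← Nat.card_congr e1, Nat.card_congr e2, Nat.card_congr e3, Nat.card_eq_fintype_card,
    Fintype.card_coe, List.toFinset_card_of_nodup hnd]

/-! ### Companion matrices as linear maps -/

theorem companionMatrix_eq (q : ℤ[X]) : companionMatrix q =
    !![0, 0, 0, 0, -q.coeff 0; 1, 0, 0, 0, -q.coeff 1; 0, 1, 0, 0, -q.coeff 2;
      0, 0, 1, 0, -q.coeff 3; 0, 0, 0, 1, -q.coeff 4] := by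
  ext i j
  fin_cases i <;> fin_cases j <;> rfl

/-- The linear map on `K⁵` given by the companion matrix of `q`. -/
noncomputable def compOn (K : Type*) [Field K] (q : ℤ[X]) : (Fin 5 → K) →ₗ[K] (Fin 5 → K) :=
  Matrix.toLin' ((companionMatrix q).map (Int.cast : ℤ → K))

section Companion

variable {K : Type*} [Field K]

theorem compOn_apply (q : ℤ[X]) (x : Fin 5 → K) :
    compOn K q x = ![-(q.coeff 0 : K) * x 4, x 0 - q.coeff 1 * x 4, x 1 - q.coeff 2 * x 4,
      x 2 - q.coeff 3 * x 4, x 3 - q.coeff 4 * x 4] := by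
  ext i
  rw [compOn, Matrix.toLin'_apply, companionMatrix_eq, Matrix.mulVec, dotProduct]
  fin_cases i <;> simp [Fin.sum_univ_five] <;> ring

theorem compOn_single (q : ℤ[X]) (i : Fin 4) :
    compOn K q (Pi.single i.castSucc 1) = Pi.single i.succ 1 := by
  rw [compOn_apply]
  ext j
  fin_cases i <;> fin_cases j <;> simp [Fin.ext_iff]

theorem compOn_eq_of_last_eq_zero (f g : ℤ[X]) (x : Fin 5 → K) (h : x 4 = 0) :
    compOn K f x = compOn K g x := by
  rw [compOn_apply, compOn_apply, h]
  simp

/-- The vector `w` with `A x - B x = x₅ w`, where `A`, `B` are the companion matrices of `f`,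
`g`. -/
def diffVec (K : Type*) [Field K] (f g : ℤ[X]) : Fin 5 → K :=
  fun i => ((g.coeff i - f.coeff i : ℤ) : K)

theorem compOn_eq_add (f g : ℤ[X]) (x : Fin 5 → K) :
    compOn K f x = compOn K g x + x 4 • diffVec K f g := by
  rw [compOn_apply, compOn_apply]
  ext i
  fin_cases i <;> simp [diffVec] <;> ring

theorem pow_compOn_single (q : ℤ[X]) (n : Fin 5) :
    (compOn K q ^ (n : ℕ)) (Pi.single 0 1) = Pi.single n 1 := by
  induction n using Fin.induction with
  | zero => simp
  | succ i ih =>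
    rw [Fin.val_succ, pow_succ', Module.End.mul_apply]
    rw [Fin.val_castSucc] at ih
    rw [ih, compOn_single]

/-- For monic `q` of degree five, `q(A) e₁` is given by the differences of the coefficients of `q`
and `f`, where `A` is the companion matrix of `f`. -/
theorem aeval_compOn_single (f q : ℤ[X]) (hq : q.natDegree = 5) (hm : q.coeff 5 = 1) :
    aeval (compOn K f) q (Pi.single 0 1) = diffVec K f q := by
  rw [aeval_eq_sum_range' (n := 6) (by omega)]
  have h (n : Fin 5) := pow_compOn_single (K := K) f n
  have h5 : (compOn K f ^ 5) (Pi.single 0 1) = compOn K f (Pi.single 4 1) := by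
    have h4 := h 4
    rw [pow_succ', Module.End.mul_apply, ← h4]
    rfl
  have h0 := h 0
  have h1 := h 1
  have h2 := h 2
  have h3 := h 3
  have h4 := h 4
  simp only [Fin.val_zero, Fin.val_one, Fin.val_two, show ((3 : Fin 5) : ℕ) = 3 from rfl,
    show ((4 : Fin 5) : ℕ) = 4 from rfl] at h0 h1 h2 h3 h4
  simp only [Finset.sum_range_succ, Finset.sum_range_zero, zero_add, LinearMap.add_apply,
    LinearMap.smul_apply, h0, h1, h2, h3, h4, h5, hm, compOn_apply]
  ext i
  fin_cases i <;> simp [diffVec] <;> ring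

theorem map_le_of_aeval {V : Type*} [AddCommGroup V] [Module K V] {T : V →ₗ[K] V}
    {U : Submodule K V} (hU : U.map T ≤ U) (q : K[X]) {x : V} (hx : x ∈ U) :
    aeval T q x ∈ U := by
  have hT : ∀ y ∈ U, T y ∈ U := fun y hy => hU (Submodule.mem_map_of_mem hy)
  induction q using Polynomial.induction_on' with
  | add p q hp hq => simpa using U.add_mem hp hq
  | monomial n a =>
    rw [aeval_monomial, Module.End.mul_apply, Module.algebraMap_end_apply]
    refine U.smul_mem a ?_
    induction n with
    | zero => simpa
    | succ n ih =>
      rw [pow_succ', Module.End.mul_apply]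
      exact hT _ ih

theorem eq_top_of_single_mem {f : ℤ[X]} {U : Submodule K (Fin 5 → K)}
    (hU : U.map (compOn K f) ≤ U) (h : Pi.single 0 1 ∈ U) : U = ⊤ := by
  have hs : ∀ n : Fin 5, Pi.single n (1 : K) ∈ U := by
    intro n
    have := map_le_of_aeval hU (X ^ (n : ℕ)) h
    rwa [map_pow, aeval_X, pow_compOn_single] at this
  rw [eq_top_iff]
  intro x _
  rw [← Finset.univ_sum_single x]
  refine U.sum_mem fun i _ => ?_
  have := U.smul_mem (x i) (hs i)
  rwa [← Pi.single_smul', smul_eq_mul, mul_one] at this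

end Companion

/-! ### Irreducibility -/

/-- What the linear algebra uses of an admissible pair. -/
structure IsLinearPair (f g : ℤ[X]) : Prop where
  natDegree_fst : f.natDegree = 5
  natDegree_snd : g.natDegree = 5
  monic_fst : f.coeff 5 = 1
  monic_snd : g.coeff 5 = 1
  coprime : ∀ z : ℂ, ¬ (aeval z f = 0 ∧ aeval z g = 0)
  coeff_fst : f.coeff 0 = -1
  coeff_snd : g.coeff 0 = 1

theorem IsLinearPair.of_gridCoprime {i j : Fin 14} (h : GridCoprime i j) :
    IsLinearPair (gridPair i j).1 (gridPair i j).2 := by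
  have hadm := isAdmissible_gridPair h
  refine ⟨hadm.natDegree_fst, hadm.natDegree_snd, ?_, ?_, hadm.no_common_root, ?_, ?_⟩
  · rw [gridPair_eq]; exact (fPoly_coeff _ _).2.2.2.2.2
  · rw [gridPair_eq]; exact (gPoly_coeff _ _).2.2.2.2.2
  · rw [gridPair_eq]; exact (fPoly_coeff _ _).1
  · rw [gridPair_eq]; exact (gPoly_coeff _ _).1

namespace IsLinearPair

variable {f g : ℤ[X]} {K : Type*} [Field K]

theorem exists_bezout [CharZero K] (h : IsLinearPair f g) :
    ∃ u v : K[X], u * f.map (Int.castRingHom K) + v * g.map (Int.castRingHom K) = 1 := by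
  have hQ : IsCoprime (f.map (Int.castRingHom ℚ)) (g.map (Int.castRingHom ℚ)) := by
    rw [isCoprime_iff_aeval_ne_zero_of_isAlgClosed ℚ ℂ]
    intro z
    have := h.coprime z
    rw [← algebraMap_int_eq, aeval_map_algebraMap, aeval_map_algebraMap]
    tauto
  have hK := hQ.map (mapRingHom (algebraMap ℚ K))
  simp only [coe_mapRingHom, Polynomial.map_map] at hK
  have hc : (algebraMap ℚ K).comp (Int.castRingHom ℚ) = Int.castRingHom K := RingHom.ext_int _ _
  rwa [hc] at hK

/-- The vector `w = g(A) e₁` is cyclic for the companion matrix `A` of `f`, because `g` is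
invertible modulo `f`. -/
theorem eq_top_of_diffVec_mem [CharZero K] (h : IsLinearPair f g) {U : Submodule K (Fin 5 → K)}
    (hU : U.map (compOn K f) ≤ U) (hw : diffVec K f g ∈ U) : U = ⊤ := by
  obtain ⟨u, v, huv⟩ := h.exists_bezout (K := K)
  refine eq_top_of_single_mem hU ?_
  have h1 := congrArg (fun q => aeval (compOn K f) q (Pi.single 0 1)) huv
  simp only [map_add, map_mul, LinearMap.add_apply, Module.End.mul_apply, map_one,
    Module.End.one_apply, ← algebraMap_int_eq, aeval_map_algebraMap] at h1
  rw [aeval_compOn_single f f h.natDegree_fst h.monic_fst,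
    aeval_compOn_single f g h.natDegree_snd h.monic_snd] at h1
  have h0 : diffVec K f f = 0 := by ext; simp [diffVec]
  rw [h0, map_zero, zero_add] at h1
  rw [← h1]
  exact map_le_of_aeval hU v hw

/-- The two companion matrices have no common invariant subspace: if the last coordinate vanishes
on `U`, then so do all the others, as `A` shifts coordinates; otherwise `U` contains the cyclic
vector `w`. -/
theorem eq_bot_or_eq_top [CharZero K] (h : IsLinearPair f g) {U : Submodule K (Fin 5 → K)}
    (hf : U.map (compOn K f) ≤ U) (hg : U.map (compOn K g) ≤ U) : U = ⊥ ∨ U = ⊤ := by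
  have hf' : ∀ y ∈ U, compOn K f y ∈ U := fun y hy => hf (Submodule.mem_map_of_mem hy)
  have hg' : ∀ y ∈ U, compOn K g y ∈ U := fun y hy => hg (Submodule.mem_map_of_mem hy)
  by_cases hx : ∀ x ∈ U, x 4 = 0
  · left
    rw [eq_bot_iff]
    intro x hxU
    have x4 := hx x hxU
    have x3 : x 3 = 0 := by
      have := hx _ (hf' x hxU)
      simpa [compOn_apply, x4] using this
    have x2 : x 2 = 0 := by
      have := hx _ (hf' _ (hf' x hxU))
      simpa [compOn_apply, x4, x3] using this
    have x1 : x 1 = 0 := by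
      have := hx _ (hf' _ (hf' _ (hf' x hxU)))
      simpa [compOn_apply, x4, x3, x2] using this
    have x0 : x 0 = 0 := by
      have := hx _ (hf' _ (hf' _ (hf' _ (hf' x hxU))))
      simpa [compOn_apply, x4, x3, x2, x1] using this
    rw [Submodule.mem_bot]
    ext i
    fin_cases i <;> assumption
  · right
    push Not at hx
    obtain ⟨x, hxU, hx4⟩ := hx
    refine h.eq_top_of_diffVec_mem hf ?_
    have h1 : x 4 • diffVec K f g ∈ U := by
      rw [← add_sub_cancel_left (compOn K g x) (x 4 • diffVec K f g), ← compOn_eq_add]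
      exact U.sub_mem (hf' x hxU) (hg' x hxU)
    exact (U.smul_mem_iff hx4).1 h1

theorem injective_fst (h : IsLinearPair f g) : Function.Injective (compOn K f) := by
  rw [injective_iff_map_eq_zero]
  intro x hx
  rw [compOn_apply, h.coeff_fst] at hx
  have h0 := congrFun hx 0
  have h1 := congrFun hx 1
  have h2 := congrFun hx 2
  have h3 := congrFun hx 3
  have h4 := congrFun hx 4
  simp at h0 h1 h2 h3 h4
  simp only [h0, mul_zero, sub_zero] at h1 h2 h3 h4
  ext i
  fin_cases i <;> assumption

theorem injective_snd (h : IsLinearPair f g) : Function.Injective (compOn K g) := by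
  rw [injective_iff_map_eq_zero]
  intro x hx
  rw [compOn_apply, h.coeff_snd] at hx
  have h0 := congrFun hx 0
  have h1 := congrFun hx 1
  have h2 := congrFun hx 2
  have h3 := congrFun hx 3
  have h4 := congrFun hx 4
  simp at h0 h1 h2 h3 h4
  simp only [h0, mul_zero, sub_zero] at h1 h2 h3 h4
  ext i
  fin_cases i <;> assumption

/-- An invariant bilinear form `β` satisfies `β(Ax, w) = 0` whenever `x₅ = 0`, since then
`Ax = Bx`. So `β(·, w)` is determined by `β(e₁, w)`, and so is `β`, as `w` is cyclic. -/
theorem bilinForm_eq_zero [CharZero K] (h : IsLinearPair f g)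
    (β : LinearMap.BilinForm K (Fin 5 → K))
    (hf : ∀ x y, β (compOn K f x) (compOn K f y) = β x y)
    (hg : ∀ x y, β (compOn K g x) (compOn K g y) = β x y)
    (h0 : β (Pi.single 0 1) (diffVec K f g) = 0) : β = 0 := by
  have hs : ∀ i : Fin 4, β (Pi.single i.succ 1) (diffVec K f g) = 0 := by
    intro i
    have h1 := hf (Pi.single i.castSucc 1) (Pi.single 4 1)
    rw [compOn_eq_add f g (Pi.single 4 1), map_add, compOn_eq_of_last_eq_zero f g, hg,
      Pi.single_eq_same, one_smul, add_eq_left, compOn_single] at h1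
    · exact h1
    · fin_cases i <;> simp
  have hall : ∀ x, β x (diffVec K f g) = 0 := by
    intro x
    rw [← Finset.univ_sum_single x, map_sum, LinearMap.sum_apply]
    refine Finset.sum_eq_zero fun i _ => ?_
    have hi : β (Pi.single i 1) (diffVec K f g) = 0 := by
      cases i using Fin.cases with
      | zero => exact h0
      | succ i => exact hs i
    rw [← mul_one (x i), ← smul_eq_mul, Pi.single_smul', map_smul, LinearMap.smul_apply, hi,
      smul_zero]
  have hsurj : Function.Surjective (compOn K f) :=
    LinearMap.injective_iff_surjective.1 h.injective_fst
  have htop := h.eq_top_of_diffVec_mem (U := LinearMap.ker (LinearMap.flip β)) (by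
    rintro - ⟨y, hy, rfl⟩
    rw [SetLike.mem_coe, LinearMap.mem_ker] at hy
    rw [LinearMap.mem_ker]
    refine LinearMap.ext fun x => ?_
    obtain ⟨x, rfl⟩ := hsurj x
    rw [LinearMap.flip_apply, hf, ← LinearMap.flip_apply, hy]
    rfl) (by
    rw [LinearMap.mem_ker]
    exact LinearMap.ext hall)
  have := LinearMap.ker_eq_top.1 htop
  refine LinearMap.ext fun x => LinearMap.ext fun y => ?_
  have h2 := LinearMap.congr_fun (LinearMap.congr_fun this y) x
  simpa using h2

end IsLinearPair

/-! ### The hypergeometric group -/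

theorem det_companionMatrix (q : ℤ[X]) : (companionMatrix q).det = -q.coeff 0 := by
  simp [companionMatrix_eq, Matrix.det_succ_row_zero, Fin.sum_univ_succ, Fin.succAbove]

theorem exists_GL_companionMatrix {q : ℤ[X]} (hq : q.coeff 0 = 1 ∨ q.coeff 0 = -1) :
    ∃ γ : GL (Fin 5) ℤ, (γ : Matrix (Fin 5) (Fin 5) ℤ) = companionMatrix q :=
  ⟨Matrix.GeneralLinearGroup.mk'' (companionMatrix q) (by
    rw [det_companionMatrix, Int.isUnit_iff]
    rcases hq with h | h <;> simp [h]), rfl⟩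

theorem actOn_one (K : Type*) [Field K] : actOn K 1 = LinearMap.id := by
  simp [actOn, Matrix.map_one]

theorem actOn_mul (K : Type*) [Field K] (γ δ : GL (Fin 5) ℤ) :
    actOn K (γ * δ) = actOn K γ ∘ₗ actOn K δ := by
  rw [actOn, actOn, actOn, ← Matrix.toLin'_mul]
  congr 1
  exact Matrix.map_mul (f := Int.castRingHom K)

theorem actOn_inv_apply (K : Type*) [Field K] (γ : GL (Fin 5) ℤ) (x : Fin 5 → K) :
    actOn K γ (actOn K γ⁻¹ x) = x := by
  rw [← LinearMap.comp_apply, ← actOn_mul, mul_inv_cancel, actOn_one, LinearMap.id_apply]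

theorem actOn_eq_compOn (K : Type*) [Field K] {γ : GL (Fin 5) ℤ} {q : ℤ[X]}
    (h : (γ : Matrix (Fin 5) (Fin 5) ℤ) = companionMatrix q) : actOn K γ = compOn K q := by
  rw [actOn, compOn, h]

/-- A property of group elements which holds for the two companion matrices and is compatible with
the group operations holds on the hypergeometric group. -/
theorem hypergeometricGroup_induction {p : ℤ[X] × ℤ[X]} {P : GL (Fin 5) ℤ → Prop}
    (h1 : ∀ γ : GL (Fin 5) ℤ, (γ : Matrix (Fin 5) (Fin 5) ℤ) = companionMatrix p.1 → P γ)
    (h2 : ∀ γ : GL (Fin 5) ℤ, (γ : Matrix (Fin 5) (Fin 5) ℤ) = companionMatrix p.2 → P γ)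
    (one : P 1) (mul : ∀ γ δ, P γ → P δ → P (γ * δ)) (inv : ∀ γ, P γ → P γ⁻¹)
    (γ : GL (Fin 5) ℤ) (hγ : γ ∈ hypergeometricGroup p) : P γ := by
  induction hγ using Subgroup.closure_induction with
  | mem γ hγ => exact hγ.elim (h1 γ) (h2 γ)
  | one => exact one
  | mul γ δ _ _ h h' => exact mul γ δ h h'
  | inv γ _ h => exact inv γ h

theorem isInvariantForm_iff {p : ℤ[X] × ℤ[X]} (h : IsLinearPair p.1 p.2)
    (Q : QuadraticForm ℚ (Fin 5 → ℚ)) : IsInvariantForm p Q ↔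
      (∀ x, Q (compOn ℚ p.1 x) = Q x) ∧ ∀ x, Q (compOn ℚ p.2 x) = Q x := by
  constructor
  · intro hQ
    obtain ⟨γ, hγ⟩ := exists_GL_companionMatrix (Or.inr h.coeff_fst)
    obtain ⟨δ, hδ⟩ := exists_GL_companionMatrix (Or.inl h.coeff_snd)
    rw [← actOn_eq_compOn ℚ hγ, ← actOn_eq_compOn ℚ hδ]
    exact ⟨hQ γ (Subgroup.subset_closure (Or.inl hγ)), hQ δ (Subgroup.subset_closure (Or.inr hδ))⟩
  · rintro ⟨h1, h2⟩
    refine hypergeometricGroup_induction ?_ ?_ ?_ ?_ ?_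
    · intro γ hγ
      rwa [actOn_eq_compOn ℚ hγ]
    · intro γ hγ
      rwa [actOn_eq_compOn ℚ hγ]
    · simp [actOn_one]
    · intro γ δ hγ hδ x
      rw [actOn_mul, LinearMap.comp_apply, hγ, hδ]
    · intro γ hγ x
      rw [← hγ, actOn_inv_apply]

theorem IsInvariantForm.unique {p : ℤ[X] × ℤ[X]} (h : IsLinearPair p.1 p.2)
    {Q Q' : QuadraticForm ℚ (Fin 5 → ℚ)} (hQ : IsInvariantForm p Q) (hQ' : IsInvariantForm p Q')
    (hne : Q ≠ 0) : ∃ c : ℚ, Q' = c • Q := by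
  have hpol : ∀ {R : QuadraticForm ℚ (Fin 5 → ℚ)}, IsInvariantForm p R →
      R.polarBilin (Pi.single 0 1) (diffVec ℚ p.1 p.2) = 0 → R = 0 := by
    intro R hR h0
    obtain ⟨h1, h2⟩ := (isInvariantForm_iff h R).1 hR
    have hβ := h.bilinForm_eq_zero R.polarBilin
      (fun x y => by simp only [QuadraticMap.polarBilin_apply_apply, QuadraticMap.polar,
        ← map_add, h1])
      (fun x y => by simp only [QuadraticMap.polarBilin_apply_apply, QuadraticMap.polar,
        ← map_add, h2]) h0
    ext x
    have := LinearMap.congr_fun (LinearMap.congr_fun hβ x) x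
    rw [QuadraticMap.polarBilin_apply_apply, QuadraticMap.polar_self] at this
    simpa using this
  set a := Q.polarBilin (Pi.single 0 1) (diffVec ℚ p.1 p.2) with ha
  set a' := Q'.polarBilin (Pi.single 0 1) (diffVec ℚ p.1 p.2) with ha'
  have ha0 : a ≠ 0 := fun h0 => hne (hpol hQ h0)
  refine ⟨a' / a, ?_⟩
  rw [← sub_eq_zero]
  refine hpol (fun γ hγ x => ?_) ?_
  · simp [hQ γ hγ x, hQ' γ hγ x]
  · have e1 : (Q' - (a' / a) • Q).polarBilin (Pi.single 0 1) (diffVec ℚ p.1 p.2) =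
        a' - a' / a * a := by
      rw [ha, ha']
      simp only [QuadraticMap.polarBilin_apply_apply, QuadraticMap.polar, sub_apply,
        smul_apply, smul_eq_mul]
      ring
    rw [e1, div_mul_cancel₀ _ ha0, sub_self]

/-! ### Signatures -/

open QuadraticForm QuadraticMap in
/-- The signature can be read off an orthogonal family of non-isotropic vectors. -/
theorem signature_of_orthogonal (Q : QuadraticForm ℚ (Fin 5 → ℚ)) (v : Fin 5 → Fin 5 → ℚ)
    (hv : ∀ i j, i ≠ j → polar Q (v i) (v j) = 0) (hne : ∀ i, Q (v i) ≠ 0) :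
    sigPos Q = (Finset.univ.filter fun i => 0 < Q (v i)).card ∧
    sigNeg Q = (Finset.univ.filter fun i => Q (v i) < 0).card := by
  have hortho : (associated (R := ℚ) Q).IsOrthoᵢ v := by
    intro i j hij
    have h2 : (2 : ℚ) • associated (R := ℚ) Q (v i) (v j) = 0 := by
      rw [← hv i j hij, ← polarBilin_apply_apply, ← two_nsmul_associated ℚ]
      simp [two_mul, two_smul]
    simpa using h2
  have hli : LinearIndependent ℚ v := by
    refine LinearMap.BilinForm.linearIndependent_of_iIsOrtho hortho fun i hi => hne i ?_
    rw [← associated_eq_self_apply ℚ Q]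
    exact hi
  let b := basisOfLinearIndependentOfCardEqFinrank hli (by simp)
  have hb : ⇑b = v := coe_basisOfLinearIndependentOfCardEqFinrank hli (by simp)
  have he : Equivalent Q (weightedSumSquares ℚ fun i => Q (v i)) := by
    have h1 := basisRepr_eq_of_iIsOrtho Q b (by rwa [hb])
    rw [hb] at h1
    rw [← h1]
    exact ⟨isometryEquivBasisRepr Q b⟩
  constructor
  · rw [sigPos_of_equiv_weightedSumSquares he, Set.ncard_eq_toFinset_card']
    simp
  · rw [sigNeg_of_equiv_weightedSumSquares he, Set.ncard_eq_toFinset_card']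
    simp

section Scaling

variable {V : Type*} [AddCommGroup V] [Module ℚ V] [FiniteDimensional ℚ V]

theorem sigPos_le_sigPos_smul (Q : QuadraticForm ℚ V) {c : ℚ} (hc : 0 < c) :
    sigPos Q ≤ sigPos (c • Q) := by
  obtain ⟨W, hW, hpos⟩ := exists_finrank_eq_sigPos_and_posDef Q
  rw [← hW]
  refine le_sigPos_of_posDef _ fun x hx => ?_
  exact mul_pos hc (hpos x hx)

theorem sigPos_smul (Q : QuadraticForm ℚ V) {c : ℚ} (hc : 0 < c) :
    sigPos (c • Q) = sigPos Q := by
  refine le_antisymm ?_ (sigPos_le_sigPos_smul Q hc)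
  have := sigPos_le_sigPos_smul (c • Q) (inv_pos.2 hc)
  rwa [smul_smul, inv_mul_cancel₀ hc.ne', one_smul] at this

theorem sigNeg_smul (Q : QuadraticForm ℚ V) {c : ℚ} (hc : 0 < c) :
    sigNeg (c • Q) = sigNeg Q := by
  rw [← sigPos_neg, ← smul_neg, sigPos_smul _ hc, sigPos_neg]

theorem exists_pos_of_sigPos_pos (Q : QuadraticForm ℚ V) (h : 0 < sigPos Q) :
    ∃ x, 0 < Q x := by
  obtain ⟨W, hW, hpos⟩ := exists_finrank_eq_sigPos_and_posDef Q
  have : Nontrivial W := Module.finrank_pos_iff.1 (hW ▸ h)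
  obtain ⟨x, hx⟩ := exists_ne (0 : W)
  exact ⟨x, hpos x hx⟩

theorem posDef_of_sigPos_eq_finrank (Q : QuadraticForm ℚ V)
    (h : sigPos Q = Module.finrank ℚ V) : Q.PosDef := by
  obtain ⟨W, hW, hpos⟩ := exists_finrank_eq_sigPos_and_posDef Q
  have hT : W = ⊤ := Submodule.eq_top_of_finrank_eq (hW.trans h)
  intro x hx
  exact hpos ⟨x, hT ▸ Submodule.mem_top⟩ (by simpa using hx)

end Scaling

/-- The invariant form being unique up to scalars, its signature is determined up to order. -/
theorem hasSignature_iff {p : ℤ[X] × ℤ[X]} (h : IsLinearPair p.1 p.2)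
    {Q : QuadraticForm ℚ (Fin 5 → ℚ)} (hQ : IsInvariantForm p Q) (hne : Q ≠ 0) (a b : ℕ) :
    HasSignature p a b ↔ (sigPos Q = a ∧ sigNeg Q = b) ∨
      (sigPos Q = b ∧ sigNeg Q = a) := by
  constructor
  · rintro ⟨R, hR, huniq, ha, hb⟩
    obtain ⟨c, rfl⟩ := hQ.unique h hR hne
    rcases lt_trichotomy c 0 with hc | rfl | hc
    · right
      have e : c • Q = (-c) • (-Q) := by rw [smul_neg, neg_smul, neg_neg]
      rw [e, sigPos_smul _ (neg_pos.2 hc), sigPos_neg] at ha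
      rw [e, sigNeg_smul _ (neg_pos.2 hc), sigNeg_neg] at hb
      exact ⟨hb, ha⟩
    · obtain ⟨d, hd⟩ := huniq Q hQ
      rw [zero_smul, smul_zero] at hd
      exact absurd hd hne
    · left
      rw [sigPos_smul _ hc] at ha
      rw [sigNeg_smul _ hc] at hb
      exact ⟨ha, hb⟩
  · rintro (⟨ha, hb⟩ | ⟨hb, ha⟩)
    · exact ⟨Q, hQ, fun Q' hQ' => hQ.unique h hQ' hne, ha, hb⟩
    · have hQn : IsInvariantForm p (-Q) := fun γ hγ x => by
        simp [hQ γ hγ x]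
      refine ⟨-Q, hQn, fun Q' hQ' => hQn.unique h hQ' (neg_ne_zero.2 hne), ?_, ?_⟩
      · rw [sigPos_neg, ha]
      · rw [sigNeg_neg, hb]

/-! ### Finiteness of the hypergeometric group -/

/-- A positive definite form bounds the coordinates: the `i`-th coordinate is `β(u, ·)` for some
`u`, and the Cauchy-Schwarz inequality applies. -/
theorem exists_coord_sq_le {n : ℕ} {Q : QuadraticForm ℚ (Fin n → ℚ)} (hQ : Q.PosDef) (i : Fin n) :
    ∃ C : ℚ, 0 ≤ C ∧ ∀ x, x i ^ 2 ≤ C * Q x := by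
  have hinj : Function.Injective Q.polarBilin := by
    rw [injective_iff_map_eq_zero]
    intro x hx
    by_contra hx0
    have h1 := LinearMap.congr_fun hx x
    rw [QuadraticMap.polarBilin_apply_apply, QuadraticMap.polar_self] at h1
    have := hQ x hx0
    simp at h1
    exact this.ne' h1
  have hsurj := (LinearMap.injective_iff_surjective_of_finrank_eq_finrank
    (by rw [Subspace.dual_finrank_eq])).1 hinj
  obtain ⟨u, hu⟩ := hsurj (LinearMap.proj i)
  have hnn : ∀ y, 0 ≤ Q y := fun y => by
    by_cases hy : y = 0
    · rw [hy, map_zero]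
    · exact (hQ y hy).le
  refine ⟨4 * Q u, mul_nonneg (by norm_num) (hnn u), fun x => ?_⟩
  have hpol : QuadraticMap.polar Q u x = x i := by
    rw [← QuadraticMap.polarBilin_apply_apply, hu]
    rfl
  have hquad : ∀ r : ℚ, 0 ≤ Q u * (r * r) + x i * r + Q x := by
    intro r
    have h1 := hnn (r • u + x)
    have h2 : Q (r • u + x) = Q (r • u) + Q x + QuadraticMap.polar Q (r • u) x := by
      rw [QuadraticMap.polar]; ring
    rw [h2, QuadraticMap.polar_smul_left, hpol, QuadraticMap.map_smul, smul_eq_mul,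
      smul_eq_mul] at h1
    linarith
  have := discrim_le_zero hquad
  rw [discrim] at this
  linarith

theorem finite_setOf_intVec_le {n : ℕ} {Q : QuadraticForm ℚ (Fin n → ℚ)} (hQ : Q.PosDef) (c : ℚ) :
    {x : Fin n → ℤ | Q (fun i => (x i : ℚ)) ≤ c}.Finite := by
  choose C hC0 hC using fun i => exists_coord_sq_le hQ i
  refine (Set.Finite.pi' fun i => Set.finite_Icc (-⌈C i * c⌉) ⌈C i * c⌉).subset fun x hx i => ?_
  rw [Set.mem_ofPred_eq] at hx
  have h1 : (x i : ℚ) ^ 2 ≤ C i * c :=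
    (hC i _).trans (mul_le_mul_of_nonneg_left hx (hC0 i))
  have h2 : x i ^ 2 ≤ ⌈C i * c⌉ := by
    have := h1.trans (Int.le_ceil _)
    exact_mod_cast this
  rw [Set.mem_Icc]
  constructor <;> nlinarith [sq_nonneg (x i + 1), sq_nonneg (x i - 1), sq_nonneg (x i)]

/-- The columns of an element of the group are integral vectors of bounded length. -/
theorem finite_of_posDef {p : ℤ[X] × ℤ[X]} {Q : QuadraticForm ℚ (Fin 5 → ℚ)}
    (hQ : IsInvariantForm p Q) (hpos : Q.PosDef) : Finite (hypergeometricGroup p) := by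
  let S : Fin 5 → Set (Fin 5 → ℤ) := fun j =>
    {x : Fin 5 → ℤ | Q (fun i => (x i : ℚ)) ≤ Q (Pi.single j 1)}
  have hS : ∀ j, Finite (S j) := fun j => finite_setOf_intVec_le hpos _
  refine Finite.of_injective (β := ∀ j, S j)
    (fun γ j => ⟨fun i => (γ.1 : Matrix (Fin 5) (Fin 5) ℤ) i j, ?_⟩) ?_
  · have := hQ γ.1 γ.2 (Pi.single j 1)
    rw [actOn, Matrix.toLin'_apply, Matrix.mulVec_single_one] at this
    exact this.le
  · intro γ δ h
    refine Subtype.ext (Units.ext (Matrix.ext fun i j => ?_))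
    have := congrArg Subtype.val (congrFun h j)
    exact congrFun this i

/-- A finite group preserves the sum of the translates of `∑ xᵢ²`, which is positive definite; so
the invariant form is definite. -/
theorem infinite_of_indefinite {p : ℤ[X] × ℤ[X]} (h : IsLinearPair p.1 p.2)
    {Q : QuadraticForm ℚ (Fin 5 → ℚ)} (hQ : IsInvariantForm p Q)
    (hpos : 0 < sigPos Q) (hneg : 0 < sigNeg Q) :
    Infinite (hypergeometricGroup p) := by
  rw [← not_finite_iff_infinite]
  intro hfin
  have := Fintype.ofFinite (hypergeometricGroup p)
  obtain ⟨x, hx⟩ := exists_pos_of_sigPos_pos Q hpos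
  obtain ⟨y, hy⟩ := exists_pos_of_sigPos_pos (-Q) hneg
  have hne : Q ≠ 0 := by
    rintro rfl
    exact lt_irrefl _ hx
  let S : QuadraticForm ℚ (Fin 5 → ℚ) := QuadraticMap.weightedSumSquares ℚ fun _ : Fin 5 => (1 : ℚ)
  have hS0 : ∀ z, 0 ≤ S z := fun z => by
    simp only [S, QuadraticMap.weightedSumSquares_apply, one_smul]
    exact Finset.sum_nonneg fun i _ => mul_self_nonneg _
  have hS : ∀ z, S z = 0 → z = 0 := fun z hz => by
    simp only [S, QuadraticMap.weightedSumSquares_apply, one_smul] at hz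
    rw [Finset.sum_eq_zero_iff_of_nonneg fun i _ => mul_self_nonneg _] at hz
    ext i
    exact mul_self_eq_zero.1 (hz i (Finset.mem_univ i))
  let R : QuadraticForm ℚ (Fin 5 → ℚ) :=
    ∑ γ : hypergeometricGroup p, S.comp (actOn ℚ γ.1)
  have hRapp : ∀ z, R z = ∑ γ : hypergeometricGroup p, S (actOn ℚ γ.1 z) := fun z => by
    simp [R]
  have hR : IsInvariantForm p R := by
    intro γ hγ z
    rw [hRapp, hRapp]
    refine (Finset.sum_congr rfl fun δ _ => ?_).trans
      (Equiv.sum_comp (Equiv.mulRight (⟨γ, hγ⟩ : hypergeometricGroup p)) _)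
    simp [actOn_mul]
  have hRpos : ∀ z, z ≠ 0 → 0 < R z := fun z hz => by
    rw [hRapp]
    refine lt_of_lt_of_le ((hS0 z).lt_of_ne fun h0 => hz (hS z h0.symm)) ?_
    have := Finset.single_le_sum (f := fun γ : hypergeometricGroup p => S (actOn ℚ γ.1 z))
      (fun γ _ => hS0 _) (Finset.mem_univ 1)
    simpa [actOn_one] using this
  obtain ⟨c, hc⟩ := hQ.unique h hR hne
  have hx0 : x ≠ 0 := by
    rintro rfl
    simp at hx
  have hy0 : y ≠ 0 := by
    rintro rfl
    simp at hy
  have h1 := hRpos x hx0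
  have h2 := hRpos y hy0
  rw [hc] at h1 h2
  simp only [smul_apply, smul_eq_mul, neg_apply, Left.neg_pos_iff] at h1 h2 hy
  have hc1 : 0 < c := pos_of_mul_pos_left h1 hx.le
  exact absurd h2 (mul_neg_of_pos_of_neg hc1 hy).not_gt

/-! ### The invariant form -/

/-- The form with matrix `(t_{|i - j|})`. -/
noncomputable def toeplitzForm (t : Fin 5 → ℤ) : QuadraticForm ℚ (Fin 5 → ℚ) :=
  ((!![t 0, t 1, t 2, t 3, t 4; t 1, t 0, t 1, t 2, t 3; t 2, t 1, t 0, t 1, t 2;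
    t 3, t 2, t 1, t 0, t 1; t 4, t 3, t 2, t 1, t 0] : Matrix (Fin 5) (Fin 5) ℤ).map
    (Int.cast : ℤ → ℚ)).toQuadraticForm'

theorem toeplitzForm_apply (t : Fin 5 → ℤ) (x : Fin 5 → ℚ) :
    toeplitzForm t x = t 0 * (x 0 ^ 2 + x 1 ^ 2 + x 2 ^ 2 + x 3 ^ 2 + x 4 ^ 2) +
      2 * t 1 * (x 0 * x 1 + x 1 * x 2 + x 2 * x 3 + x 3 * x 4) +
      2 * t 2 * (x 0 * x 2 + x 1 * x 3 + x 2 * x 4) + 2 * t 3 * (x 0 * x 3 + x 1 * x 4) +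
      2 * t 4 * (x 0 * x 4) := by
  simp [toeplitzForm, Matrix.toQuadraticForm', Matrix.toLinearMap₂'_apply, Fin.sum_univ_five]
  ring

/-- The first row of the matrix of the invariant form for `f = fPoly a b`, `g = gPoly c d`. It
solves the linear equations which say that `e₂, …, e₅` are orthogonal to `w`. -/
def gramRow (a b c d : ℤ) : Fin 5 → ℤ :=
  let u := 2 - 2 * a + b
  let v := 2 - 2 * c + d
  let s := a + c
  let e := d - b
  let m := (s - 4) * e + s * (u - v)
  let n := 2 * s * (s - 4)
  let k := 8 * u * v
  let t0 := -(u + v) * n - (u - v) * m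
  let t1 := -(u + v) * m - (u - v) * n
  let t2 := t0 - s * k
  let t3 := t1 - e * k
  ![4 * t0, 4 * t1, 4 * t2, 4 * t3,
    (2 * s - 4) * t0 + (u - v) * (t1 + t3) - 2 * (u + v + s - 4) * t2 - e ^ 2 * k]

theorem toeplitzForm_compOn_fPoly (a b c d : ℤ) (x : Fin 5 → ℚ) :
    toeplitzForm (gramRow a b c d) (compOn ℚ (fPoly a b) x) =
      toeplitzForm (gramRow a b c d) x := by
  obtain ⟨f0, f1, f2, f3, f4, -⟩ := fPoly_coeff a b
  simp only [toeplitzForm_apply, compOn_apply, f0, f1, f2, f3, f4]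
  simp [gramRow]
  ring

theorem toeplitzForm_compOn_gPoly (a b c d : ℤ) (x : Fin 5 → ℚ) :
    toeplitzForm (gramRow a b c d) (compOn ℚ (gPoly c d) x) =
      toeplitzForm (gramRow a b c d) x := by
  obtain ⟨f0, f1, f2, f3, f4, -⟩ := gPoly_coeff c d
  simp only [toeplitzForm_apply, compOn_apply, f0, f1, f2, f3, f4]
  simp [gramRow]
  ring

theorem polar_toeplitzForm (t : Fin 5 → ℤ) (x y : Fin 5 → ℚ) :
    QuadraticMap.polar (toeplitzForm t) x y =
      2 * t 0 * (x 0 * y 0 + x 1 * y 1 + x 2 * y 2 + x 3 * y 3 + x 4 * y 4) +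
      2 * t 1 * (x 0 * y 1 + y 0 * x 1 + x 1 * y 2 + y 1 * x 2 + x 2 * y 3 + y 2 * x 3 +
        x 3 * y 4 + y 3 * x 4) +
      2 * t 2 * (x 0 * y 2 + y 0 * x 2 + x 1 * y 3 + y 1 * x 3 + x 2 * y 4 + y 2 * x 4) +
      2 * t 3 * (x 0 * y 3 + y 0 * x 3 + x 1 * y 4 + y 1 * x 4) +
      2 * t 4 * (x 0 * y 4 + y 0 * x 4) := by
  rw [QuadraticMap.polar, toeplitzForm_apply, toeplitzForm_apply, toeplitzForm_apply]
  simp only [Pi.add_apply]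
  ring

/-- The entries of the matrix of a Toeplitz form, relative to the basis
`e₁ - e₅, e₂ - e₄, e₁ + e₅, e₂ + e₄, e₃`, in which it splits into two blocks; those of the first
block are halved. -/
structure ToeplitzBlocks where
  (n00 n01 n11 m00 m01 m02 m11 m12 m22 : ℤ)

/-- The blocks of the matrix `(t_{|i - j|})`. -/
def toeplitzBlocks (t : Fin 5 → ℤ) : ToeplitzBlocks where
  n00 := t 0 - t 4
  n01 := t 1 - t 3
  n11 := t 0 - t 2
  m00 := 2 * (t 0 + t 4)
  m01 := 2 * (t 1 + t 3)
  m02 := 2 * t 2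
  m11 := 2 * (t 0 + t 2)
  m12 := 2 * t 1
  m22 := t 0

/-- Orthogonal vectors for a Toeplitz form: `x, y` are the coordinates of the first vector in the
span of `e₁ - e₅, e₂ - e₄`; the vectors in the span of `g₀ = e₁ + e₅, g₁ = e₂ + e₄, g₂ = e₃` are
obtained by orthogonalizing `g₀, g₁, g₂`, or `g₂, g₁, g₀` if `r` holds. -/
def orthVec (B : ToeplitzBlocks) (x y : ℤ) (r : Bool) : Fin 5 → Fin 5 → ℤ :=
  let anti := fun x y : ℤ => ![x, y, 0, -y, -x]
  let sym := fun x y z : ℤ => ![x, y, z, y, x]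
  ![anti x y, anti (-(x * B.n01 + y * B.n11)) (x * B.n00 + y * B.n01),
    if r then sym 0 0 1 else sym 1 0 0,
    if r then sym 0 B.m22 (-B.m12) else sym (-B.m01) B.m00 0,
    if r then
      sym (B.m11 * B.m22 - B.m12 ^ 2) (B.m12 * B.m02 - B.m01 * B.m22)
        (B.m01 * B.m12 - B.m11 * B.m02)
    else
      sym (B.m01 * B.m12 - B.m02 * B.m11) (B.m02 * B.m01 - B.m00 * B.m12)
        (B.m00 * B.m11 - B.m01 ^ 2)]

/-- The values of the form at the vectors `orthVec`. -/
def orthVal (B : ToeplitzBlocks) (x y : ℤ) (r : Bool) : Fin 5 → ℤ :=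
  let q := 2 * (x ^ 2 * B.n00 + 2 * x * y * B.n01 + y ^ 2 * B.n11)
  let δ := if r then B.m11 * B.m22 - B.m12 ^ 2 else B.m00 * B.m11 - B.m01 ^ 2
  let ε := if r then B.m22 else B.m00
  let det := B.m00 * (B.m11 * B.m22 - B.m12 ^ 2) - B.m01 * (B.m01 * B.m22 - B.m12 * B.m02) +
    B.m02 * (B.m01 * B.m12 - B.m11 * B.m02)
  ![q, (B.n00 * B.n11 - B.n01 ^ 2) * q, ε, ε * δ, det * δ]

theorem toeplitzForm_orthVec (t : Fin 5 → ℤ) (x y : ℤ) (r : Bool) (i : Fin 5) :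
    toeplitzForm t (fun n => orthVec (toeplitzBlocks t) x y r i n) =
      orthVal (toeplitzBlocks t) x y r i := by
  rw [toeplitzForm_apply]
  cases r <;> fin_cases i <;> simp [orthVec, orthVal, toeplitzBlocks] <;> ring

theorem polar_orthVec (t : Fin 5 → ℤ) (x y : ℤ) (r : Bool) (i j : Fin 5) (hij : i ≠ j) :
    QuadraticMap.polar (toeplitzForm t) (fun n => orthVec (toeplitzBlocks t) x y r i n)
      (fun n => orthVec (toeplitzBlocks t) x y r j n) = 0 := by
  wlog h : i < j generalizing i j
  · rw [QuadraticMap.polar_comm]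
    exact this j i hij.symm (lt_of_le_of_ne (not_lt.1 h) hij.symm)
  rw [polar_toeplitzForm]
  cases r <;> fin_cases i <;> fin_cases j <;>
    first
    | exact absurd h (by decide)
    | (simp [orthVec, toeplitzBlocks]; try ring)

theorem signature_toeplitzForm (t : Fin 5 → ℤ) (x y : ℤ) (r : Bool)
    (hne : ∀ i, orthVal (toeplitzBlocks t) x y r i ≠ 0) :
    sigPos (toeplitzForm t) =
      (Finset.univ.filter fun i => 0 < orthVal (toeplitzBlocks t) x y r i).card ∧
    sigNeg (toeplitzForm t) =
      (Finset.univ.filter fun i => orthVal (toeplitzBlocks t) x y r i < 0).card := by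
  have := signature_of_orthogonal (toeplitzForm t)
    (fun i n => orthVec (toeplitzBlocks t) x y r i n) (polar_orthVec t x y r)
    (fun i => by rw [toeplitzForm_orthVec]; exact_mod_cast hne i)
  simpa only [toeplitzForm_orthVec, Int.cast_pos, Int.cast_lt_zero] using this

/-- The first row of the matrix of the invariant form of `gridPair i j`. -/
def gridRow (i j : Fin 14) : Fin 5 → ℤ := gramRow (tailA i) (tailB i) (tailA j) (tailB j)

/-- The signature which the tables prescribe for the form with first row `gridRow i j`. In the
indefinite cases this form is negative on the larger subspace, so the order is the reverse of the
one in the names of the tables. -/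
def tableSignature (i j : Fin 14) : ℕ × ℕ :=
  if InTable interlacingTable i j then (5, 0)
  else if InTable realRankOneTable i j then (1, 4) else (2, 3)

/-- The signature found from the orthogonal family is the one prescribed by the tables. Several
families are needed since each of them has isotropic members for some pairs. -/
theorem exists_orthVal : ∀ i j, GridCoprime i j →
    ∃ c ∈ [((0 : ℤ), (1 : ℤ)), (1, 0), (1, 1)], ∃ r : Bool,
      let V := orthVal (toeplitzBlocks (gridRow i j)) c.1 c.2 r
      (∀ n, V n ≠ 0) ∧ (Finset.univ.filter fun n => 0 < V n).card = (tableSignature i j).1 ∧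
        (Finset.univ.filter fun n => V n < 0).card = (tableSignature i j).2 := by
  decide +kernel

theorem isInvariantForm_gridPair {i j : Fin 14} (h : GridCoprime i j) :
    IsInvariantForm (gridPair i j) (toeplitzForm (gridRow i j)) := by
  rw [isInvariantForm_iff (.of_gridCoprime h), gridPair_eq]
  exact ⟨toeplitzForm_compOn_fPoly _ _ _ _, toeplitzForm_compOn_gPoly _ _ _ _⟩

theorem signature_gridPair {i j : Fin 14} (h : GridCoprime i j) :
    sigPos (toeplitzForm (gridRow i j)) = (tableSignature i j).1 ∧
      sigNeg (toeplitzForm (gridRow i j)) = (tableSignature i j).2 := by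
  obtain ⟨c, -, r, hne, hpos, hneg⟩ := exists_orthVal i j h
  obtain ⟨h1, h2⟩ := signature_toeplitzForm _ c.1 c.2 r hne
  exact ⟨h1.trans hpos, h2.trans hneg⟩

theorem tableSignature_eq_iff : ∀ i j, GridCoprime i j →
    (tableSignature i j = (5, 0) ↔ InTable interlacingTable i j) ∧
    (tableSignature i j = (1, 4) ↔ InTable realRankOneTable i j) ∧
    (tableSignature i j = (2, 3) ↔ InTable realRankTwoTable i j) := by
  decide +kernel

theorem tableSignature_mem (i j : Fin 14) :
    tableSignature i j = (5, 0) ∨ tableSignature i j = (1, 4) ∨ tableSignature i j = (2, 3) := by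
  unfold tableSignature
  split_ifs <;> simp

theorem toeplitzForm_gridRow_ne_zero {i j : Fin 14} (h : GridCoprime i j) :
    toeplitzForm (gridRow i j) ≠ 0 := by
  intro h0
  obtain ⟨x, hx⟩ := exists_pos_of_sigPos_pos (toeplitzForm (gridRow i j)) (by
    rw [(signature_gridPair h).1]
    rcases tableSignature_mem i j with e | e | e <;> simp [e])
  simp [h0] at hx

theorem hasSignature_gridPair_iff {i j : Fin 14} (h : GridCoprime i j) (a b : ℕ) :
    HasSignature (gridPair i j) a b ↔
      tableSignature i j = (a, b) ∨ tableSignature i j = (b, a) := by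
  rw [hasSignature_iff (.of_gridCoprime h) (isInvariantForm_gridPair h)
    (toeplitzForm_gridRow_ne_zero h), (signature_gridPair h).1, (signature_gridPair h).2,
    Prod.ext_iff, Prod.ext_iff]

theorem finite_gridPair_iff {i j : Fin 14} (h : GridCoprime i j) :
    Finite (hypergeometricGroup (gridPair i j)) ↔ tableSignature i j = (5, 0) := by
  obtain ⟨hp, hn⟩ := signature_gridPair h
  constructor
  · intro hfin
    by_contra h5
    have hinf := infinite_of_indefinite (.of_gridCoprime h) (isInvariantForm_gridPair h)
      (by rw [hp]; rcases tableSignature_mem i j with e | e | e <;> simp [e])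
      (by rw [hn]; rcases tableSignature_mem i j with e | e | e <;> simp [e] at h5 ⊢)
    exact not_finite (hypergeometricGroup (gridPair i j))
  · intro h5
    refine finite_of_posDef (isInvariantForm_gridPair h) (posDef_of_sigPos_eq_finrank _ ?_)
    rw [hp, h5]
    simp

/-! ### Interlacing -/

/-- `exp(2πiq)`. -/
noncomputable def unitExp (q : ℚ) : ℂ := Complex.exp (2 * Real.pi * Complex.I * (q : ℂ))

theorem unitExp_injOn : Set.InjOn unitExp (Set.Ico 0 1) := by
  intro q hq r hr h
  obtain ⟨n, hn⟩ := Complex.exp_eq_exp_iff_exists_int.1 h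
  have h1 : (q : ℂ) = r + n := by
    have : (2 * Real.pi * Complex.I : ℂ) ≠ 0 := Complex.two_pi_I_ne_zero
    apply mul_left_cancel₀ this
    rw [hn]
    ring
  have h2 : q = r + n := by exact_mod_cast h1
  have h3 : (-1 : ℚ) < n := by linarith [hq.1, hr.2]
  have h4 : (n : ℚ) < 1 := by linarith [hq.2, hr.1]
  have h5 : n = 0 := by
    have h3' : -1 < n := by exact_mod_cast h3
    have h4' : n < 1 := by exact_mod_cast h4
    omega
  rw [h2, h5]
  simp

/-- The numbers `120 k / d`, for `d ∈ l` and `0 ≤ k < d` prime to `d`: the arguments of the roots of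
`cycloProd l`, in units of a 120th of a full turn. -/
def angles (l : List ℕ) : List ℕ :=
  l.flatMap fun d => ((List.range d).filter fun k => k.Coprime d).map fun k => k * (120 / d)

theorem map_cyclotomic_eq_prod {d : ℕ} (hd : d ∣ 120) :
    (cyclotomic d ℤ).map (Int.castRingHom ℂ) =
      ((angles [d]).map fun n : ℕ => X - C (unitExp ((n : ℚ) / 120))).prod := by
  have hd0 : 0 < d := Nat.pos_of_dvd_of_pos hd (by norm_num)
  have hdC : (d : ℂ) ≠ 0 := by exact_mod_cast hd0.ne'
  obtain ⟨e, he⟩ := hd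
  have hdiv : 120 / d = e := by rw [he, Nat.mul_div_cancel_left _ hd0]
  have hval : ∀ k : ℕ, unitExp (((k * (120 / d) : ℕ) : ℚ) / 120) =
      Complex.exp (2 * Real.pi * Complex.I * (k / d)) := by
    intro k
    rw [unitExp, hdiv]
    congr 2
    have h120 : (120 : ℂ) = d * e := by exact_mod_cast he
    have heC : (e : ℂ) ≠ 0 := by
      rintro h0
      rw [h0, mul_zero] at h120
      norm_num at h120
    push_cast
    rw [h120]
    field_simp
  rw [map_cyclotomic,
    cyclotomic_eq_prod_X_sub_primitiveRoots (Complex.isPrimitiveRoot_exp d hd0.ne')]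
  have hlist : ((angles [d]).map fun n : ℕ => X - C (unitExp ((n : ℚ) / 120))).prod =
      ∏ k ∈ (Finset.range d).filter (fun k => k.Coprime d),
        (X - C (Complex.exp (2 * Real.pi * Complex.I * (k / d)))) := by
    have hnd : ((List.range d).filter fun k => k.Coprime d).Nodup :=
      List.nodup_range.filter _
    have hset : (Finset.range d).filter (fun k => k.Coprime d) =
        ((List.range d).filter fun k => k.Coprime d).toFinset := by
      ext; simp
    rw [hset, List.prod_toFinset _ hnd]
    simp only [angles, List.flatMap_cons, List.flatMap_nil, List.append_nil, List.map_map]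
    refine congrArg List.prod (List.map_congr_left fun k _ => ?_)
    simp only [Function.comp_apply, hval]
  rw [hlist]
  symm
  refine Finset.prod_bij (fun k _ => Complex.exp (2 * Real.pi * Complex.I * (k / d))) ?_ ?_ ?_ ?_
  · intro k hk
    rw [Finset.mem_filter, Finset.mem_range] at hk
    rw [mem_primitiveRoots hd0, Complex.isPrimitiveRoot_iff _ _ hd0.ne']
    exact ⟨k, hk.1, hk.2, rfl⟩
  · intro k hk l hl hkl
    rw [Finset.mem_filter, Finset.mem_range] at hk hl
    have hdQ : (0 : ℚ) < d := by exact_mod_cast hd0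
    have h1 : (k / d : ℚ) = l / d := by
      refine unitExp_injOn ⟨by positivity, ?_⟩ ⟨by positivity, ?_⟩ ?_
      · rw [div_lt_one hdQ]; exact_mod_cast hk.1
      · rw [div_lt_one hdQ]; exact_mod_cast hl.1
      · simpa [unitExp] using hkl
    rw [div_left_inj' hdQ.ne'] at h1
    exact_mod_cast h1
  · intro z hz
    rw [mem_primitiveRoots hd0, Complex.isPrimitiveRoot_iff _ _ hd0.ne'] at hz
    obtain ⟨k, hk, hc, rfl⟩ := hz
    exact ⟨k, by rw [Finset.mem_filter, Finset.mem_range]; exact ⟨hk, hc⟩, rfl⟩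
  · intro k _
    rfl

theorem map_cycloProd_eq_prod {l : List ℕ} (hl : ∀ d ∈ l, d ∣ 120) :
    (cycloProd l).map (Int.castRingHom ℂ) =
      ((angles l).map fun n : ℕ => X - C (unitExp ((n : ℚ) / 120))).prod := by
  induction l with
  | nil => simp [cycloProd, angles]
  | cons d l ih =>
    have h1 : cycloProd (d :: l) = cyclotomic d ℤ * cycloProd l := by simp [cycloProd]
    have h2 : angles (d :: l) = angles [d] ++ angles l := by simp [angles]
    rw [h1, h2, Polynomial.map_mul, ih fun e he => hl e (List.mem_cons_of_mem _ he),
      map_cyclotomic_eq_prod (hl d List.mem_cons_self), List.map_append, List.prod_append]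

theorem angles_lt {l : List ℕ} (hl : ∀ d ∈ l, d ∣ 120) : ∀ n ∈ angles l, n < 120 := by
  intro n hn
  simp only [angles, List.mem_flatMap, List.mem_map, List.mem_filter, List.mem_range] at hn
  obtain ⟨d, hd, k, ⟨hk, -⟩, rfl⟩ := hn
  obtain ⟨e, he⟩ := hl d hd
  have hd0 : 0 < d := by omega
  have he0 : 0 < e := by
    rcases Nat.eq_zero_or_pos e with rfl | h
    · omega
    · exact h
  rw [he, Nat.mul_div_cancel_left _ hd0]
  exact Nat.mul_lt_mul_of_pos_right hk he0

/-- The parameters in `[0, 1)` are determined up to order. -/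
theorem hasParameters_cycloProd_iff {l : List ℕ} (hl : ∀ d ∈ l, d ∣ 120) {α : Fin 5 → ℚ}
    (hα : ∀ j, α j ∈ Set.Ico 0 1) : HasParameters (cycloProd l) α ↔
      Finset.univ.val.map α = (angles l : Multiset ℕ).map fun n : ℕ => (n : ℚ) / 120 := by
  have e1 : ∏ j, (X - C (Complex.exp (2 * Real.pi * Complex.I * ((α j : ℚ) : ℂ)))) =
      ((Finset.univ.val.map fun j => unitExp (α j)).map fun z => X - C z).prod := by
    rw [Multiset.map_map]
    rfl
  have e2 : ((angles l).map fun n : ℕ => X - C (unitExp ((n : ℚ) / 120))).prod =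
      (((angles l : Multiset ℕ).map fun n : ℕ => unitExp ((n : ℚ) / 120)).map
        fun z => X - C z).prod := by
    rw [Multiset.map_map, Multiset.map_coe, Multiset.prod_coe]
    rfl
  rw [HasParameters, map_cycloProd_eq_prod hl, e1, e2]
  constructor
  · intro h
    have h2 := congrArg roots h
    rw [roots_multiset_prod_X_sub_C, roots_multiset_prod_X_sub_C] at h2
    have h3 := congrArg (Multiset.map (Function.invFunOn unitExp (Set.Ico 0 1))) h2
    rw [Multiset.map_map, Multiset.map_map] at h3
    have inv : ∀ q ∈ Set.Ico (0 : ℚ) 1, Function.invFunOn unitExp (Set.Ico 0 1) (unitExp q) = q :=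
      fun q hq => unitExp_injOn.leftInvOn_invFunOn hq
    refine (Multiset.map_congr rfl fun j _ => (inv (α j) (hα j)).symm).trans
      (h3.symm.trans (Multiset.map_congr rfl fun n hn => inv _ ⟨by positivity, ?_⟩))
    rw [div_lt_one (by norm_num)]
    exact_mod_cast angles_lt hl n hn
  · intro h
    have := congrArg (Multiset.map unitExp) h
    rw [Multiset.map_map, Multiset.map_map] at this
    congr 2
    exact this.symm

/-- Between any two elements of `L` there is an element of `M`, and `L` has no repetitions. -/
abbrev IsSeparatedBy (L M : List ℕ) : Prop :=
  L.Nodup ∧ ∀ x ∈ L, ∀ y ∈ L, x < y → ∃ z ∈ M, x < z ∧ z < y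

theorem isSeparatedBy_of_map_eq {L M : List ℕ} {α β : Fin 5 → ℚ} (hα : StrictMono α)
    (hαβ : ∀ i j, i < j → ∃ k, α i < β k ∧ β k < α j)
    (hL : Finset.univ.val.map α = (L : Multiset ℕ).map fun n : ℕ => (n : ℚ) / 120)
    (hM : Finset.univ.val.map β = (M : Multiset ℕ).map fun n : ℕ => (n : ℚ) / 120) :
    IsSeparatedBy L M := by
  have hlt : ∀ {x y : ℕ}, (x : ℚ) / 120 < (y : ℚ) / 120 ↔ x < y := fun {x y} => by
    rw [div_lt_div_iff_of_pos_right (by norm_num)]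
    exact Nat.cast_lt
  constructor
  · have : (Finset.univ.val.map α).Nodup := Finset.univ.nodup.map hα.injective
    rw [hL] at this
    exact Multiset.coe_nodup.1 this.of_map
  · intro x hx y hy hxy
    have mem : ∀ x ∈ L, ∃ i, α i = (x : ℚ) / 120 := fun x hx => by
      have : (x : ℚ) / 120 ∈ Finset.univ.val.map α := by
        rw [hL]
        exact Multiset.mem_map_of_mem _ hx
      obtain ⟨i, -, hi⟩ := Multiset.mem_map.1 this
      exact ⟨i, hi⟩
    obtain ⟨i, hi⟩ := mem x hx
    obtain ⟨j, hj⟩ := mem y hy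
    obtain ⟨k, hk1, hk2⟩ := hαβ i j (hα.lt_iff_lt.1 (by rw [hi, hj]; exact hlt.2 hxy))
    have hk : β k ∈ (M : Multiset ℕ).map fun n : ℕ => (n : ℚ) / 120 := by
      rw [← hM]
      exact Multiset.mem_map_of_mem _ (Finset.mem_univ k)
    obtain ⟨z, hz, hzk⟩ := Multiset.mem_map.1 hk
    refine ⟨z, hz, ?_, ?_⟩
    · rwa [hi, ← hzk, hlt] at hk1
    · rwa [hj, ← hzk, hlt] at hk2

theorem Alternate.le {α β : Fin 5 → ℚ} (h : Alternate α β) {i j : Fin 5} (hij : i < j) :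
    β i < α j := by
  have hmono : StrictMono α := Fin.strictMono_iff_lt_succ.2 fun k =>
    (h.1 k.castSucc).trans (h.2 k)
  obtain ⟨k, rfl⟩ : ∃ k : Fin 4, i = k.castSucc := ⟨⟨i, by omega⟩, rfl⟩
  exact (h.2 k).trans_le (hmono.monotone (Fin.castSucc_lt_iff_succ_le.1 hij))

theorem Alternate.isSeparatedBy {L M : List ℕ} {α β : Fin 5 → ℚ} (h : Alternate α β)
    (hL : Finset.univ.val.map α = (L : Multiset ℕ).map fun n : ℕ => (n : ℚ) / 120)
    (hM : Finset.univ.val.map β = (M : Multiset ℕ).map fun n : ℕ => (n : ℚ) / 120) :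
    IsSeparatedBy L M ∧ IsSeparatedBy M L := by
  have hα : StrictMono α := fun i j hij => (h.1 i).trans (h.le hij)
  have hβ : StrictMono β := fun i j hij => (h.le hij).trans (h.1 j)
  exact ⟨isSeparatedBy_of_map_eq hα (fun i j hij => ⟨i, h.1 i, h.le hij⟩) hL hM,
    isSeparatedBy_of_map_eq hβ (fun i j hij => ⟨j, h.le hij, h.1 j⟩) hM hL⟩

/-- The angles in increasing order. -/
def sortedAngles (l : List ℕ) (j : Fin 5) : ℕ := ((angles l).insertionSort (· ≤ ·)).getD j 0

theorem map_sortedAngles {l : List ℕ} (h : (angles l).length = 5) :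
    Finset.univ.val.map (fun j => (sortedAngles l j : ℚ) / 120) =
      (angles l : Multiset ℕ).map fun n : ℕ => (n : ℚ) / 120 := by
  have hlen : ((angles l).insertionSort (· ≤ ·)).length = 5 := by
    rw [List.length_insertionSort, h]
  have h1 : (Finset.univ.val.map fun j => sortedAngles l j) = (angles l : Multiset ℕ) := by
    rw [← Multiset.coe_eq_coe.2 (List.perm_insertionSort (· ≤ ·) (angles l))]
    have h2 : List.ofFn (sortedAngles l) = (angles l).insertionSort (· ≤ ·) := by
      refine List.ext_getElem (by simp [hlen]) fun n h1 h2 => ?_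
      rw [List.getElem_ofFn, sortedAngles, List.getD_eq_getElem _ _ h2]
    rw [← h2]
    simp
  rw [← h1, Multiset.map_map]
  rfl

theorem sortedAngles_lt {l : List ℕ} (hl : ∀ d ∈ l, d ∣ 120) (j : Fin 5) :
    sortedAngles l j < 120 := by
  rw [sortedAngles, List.getD_eq_getElem?_getD]
  rcases lt_or_ge (j : ℕ) ((angles l).insertionSort (· ≤ ·)).length with h | h
  · rw [List.getElem?_eq_getElem h, Option.getD_some]
    refine angles_lt hl _ ?_
    rw [← (List.perm_insertionSort (· ≤ ·) (angles l)).mem_iff]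
    exact List.getElem_mem h
  · rw [List.getElem?_eq_none h]
    norm_num

/-- The condition `Alternate` for natural numbers. -/
abbrev AlternateNat (a b : Fin 5 → ℕ) : Prop :=
  (∀ j, a j < b j) ∧ ∀ j : Fin 4, b j.castSucc < a j.succ

theorem AlternateNat.alternate {a b : Fin 5 → ℕ} (h : AlternateNat a b) :
    Alternate (fun j => (a j : ℚ) / 120) (fun j => (b j : ℚ) / 120) := by
  constructor
  · intro j
    have : (a j : ℚ) < b j := by exact_mod_cast h.1 j
    simp only
    gcongr
  · intro j
    have : (b j.castSucc : ℚ) < a j.succ := by exact_mod_cast h.2 j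
    simp only
    gcongr

theorem dvd_of_mem_row (i : Fin 14) : (∀ d ∈ fRow i, d ∣ 120) ∧ ∀ d ∈ gRow i, d ∣ 120 := by
  revert i; decide

theorem length_angles (i : Fin 14) :
    (angles (fRow i)).length = 5 ∧ (angles (gRow i)).length = 5 := by
  revert i; decide +kernel

theorem alternateNat_of_inTable : ∀ i j, InTable interlacingTable i j →
    AlternateNat (sortedAngles (fRow i)) (sortedAngles (gRow j)) ∨
    AlternateNat (sortedAngles (gRow j)) (sortedAngles (fRow i)) := by
  decide +kernel

theorem inTable_of_isSeparatedBy : ∀ i j, GridCoprime i j →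
    IsSeparatedBy (angles (fRow i)) (angles (gRow j)) →
    IsSeparatedBy (angles (gRow j)) (angles (fRow i)) → InTable interlacingTable i j := by
  decide +kernel

theorem rootsInterlace_gridPair_iff {i j : Fin 14} (h : GridCoprime i j) :
    RootsInterlace (gridPair i j) ↔ InTable interlacingTable i j := by
  obtain ⟨hf, -⟩ := dvd_of_mem_row i
  obtain ⟨-, hg⟩ := dvd_of_mem_row j
  constructor
  · rintro ⟨α, β, hα, hβ, hfα, hgβ, halt⟩
    have h1 := (hasParameters_cycloProd_iff hf hα).1 hfα
    have h2 := (hasParameters_cycloProd_iff hg hβ).1 hgβ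
    rcases halt with halt | halt
    · obtain ⟨s1, s2⟩ := halt.isSeparatedBy h1 h2
      exact inTable_of_isSeparatedBy i j h s1 s2
    · obtain ⟨s1, s2⟩ := halt.isSeparatedBy h2 h1
      exact inTable_of_isSeparatedBy i j h s2 s1
  · intro hT
    have hmem : ∀ {l : List ℕ}, (∀ d ∈ l, d ∣ 120) →
        ∀ j, (sortedAngles l j : ℚ) / 120 ∈ Set.Ico (0 : ℚ) 1 := fun {l} hl j => by
      refine ⟨by positivity, ?_⟩
      rw [div_lt_one (by norm_num)]
      exact_mod_cast sortedAngles_lt hl j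
    refine ⟨fun n => (sortedAngles (fRow i) n : ℚ) / 120,
      fun n => (sortedAngles (gRow j) n : ℚ) / 120, hmem hf, hmem hg,
      (hasParameters_cycloProd_iff hf (hmem hf)).2 (map_sortedAngles (length_angles i).1),
      (hasParameters_cycloProd_iff hg (hmem hg)).2 (map_sortedAngles (length_angles j).2), ?_⟩
    exact (alternateNat_of_inTable i j hT).imp (·.alternate) (·.alternate)

/-! ### Systems of imprimitivity -/

/-- The permutation `σ` is a full cycle. -/
abbrev IsFullCycle (σ : Fin 5 → Fin 5) : Prop :=
  ∃ x, σ^[5] x = x ∧ ∀ z, ∃ k : Fin 5, σ^[k] x = z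

/-- The permutation `σ` has exactly two cycles. -/
abbrev IsTwoCycle (σ : Fin 5 → Fin 5) : Prop :=
  ∃ x y, (σ^[1] x = x ∧ σ^[4] y = y ∨ σ^[2] x = x ∧ σ^[3] y = y) ∧
    ∀ z, ∃ k : Fin 5, σ^[k] x = z ∨ σ^[k] y = z

/-- Multiplication by a transposition joins two cycles, or splits one. The values of the permutation
are quantified one after the other, each with its distinctness from the previous ones, so that the
kernel runs through permutations only. -/
theorem cycles_comp_swap : ∀ s0 s1 : Fin 5, s1 ≠ s0 → ∀ s2, s2 ≠ s0 → s2 ≠ s1 →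
    ∀ s3, s3 ≠ s0 → s3 ≠ s1 → s3 ≠ s2 → ∀ s4, s4 ≠ s0 → s4 ≠ s1 → s4 ≠ s2 → s4 ≠ s3 →
    ∀ i j, i ≠ j →
      (∀ z, ∃ k : Fin 5, (![s0, s1, s2, s3, s4])^[k] i = z ∨
        (![s0, s1, s2, s3, s4])^[k] j = z) →
      (IsFullCycle ![s0, s1, s2, s3, s4] ∧
        IsTwoCycle fun z => ![s0, s1, s2, s3, s4] (if z = i then j else if z = j then i else z)) ∨
      (IsTwoCycle ![s0, s1, s2, s3, s4] ∧
        IsFullCycle fun z =>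
          ![s0, s1, s2, s3, s4] (if z = i then j else if z = j then i else z)) := by
  decide +kernel

theorem isFullCycle_or_isTwoCycle {σ τ : Fin 5 → Fin 5} (hσ : Function.Injective σ) {i j : Fin 5}
    (hij : i ≠ j) (hi : τ i = σ j) (hj : τ j = σ i) (h : ∀ z, z ≠ i → z ≠ j → τ z = σ z)
    (horb : ∀ z, ∃ k : Fin 5, σ^[k] i = z ∨ σ^[k] j = z) :
    (IsFullCycle σ ∧ IsTwoCycle τ) ∨ (IsTwoCycle σ ∧ IsFullCycle τ) := by
  have e : σ = ![σ 0, σ 1, σ 2, σ 3, σ 4] := by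
    ext n
    fin_cases n <;> rfl
  have e' : τ = fun z => σ (if z = i then j else if z = j then i else z) := by
    funext z
    split_ifs with h1 h2
    · rw [h1, hi]
    · rw [h2, hj]
    · exact h z h1 h2
  have key := cycles_comp_swap (σ 0) (σ 1) (hσ.ne (by decide)) (σ 2) (hσ.ne (by decide))
    (hσ.ne (by decide)) (σ 3) (hσ.ne (by decide)) (hσ.ne (by decide)) (hσ.ne (by decide)) (σ 4)
    (hσ.ne (by decide)) (hσ.ne (by decide)) (hσ.ne (by decide)) (hσ.ne (by decide)) i j hij
  rw [← e, ← e'] at key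
  exact key horb

theorem exists_iterate_lt {n : ℕ} {σ : Fin n → Fin n} (hσ : Function.Injective σ) (x : Fin n) :
    ∃ k : Fin n, σ^[n] x = σ^[k] x := by
  obtain ⟨a, b, hab, h⟩ := Fintype.exists_ne_map_eq_of_card_lt
    (fun k : Fin (n + 1) => σ^[k] x) (by simp)
  wlog hlt : a < b generalizing a b
  · exact this b a hab.symm h.symm (lt_of_le_of_ne (not_lt.1 hlt) hab.symm)
  have hlt' : (a : ℕ) < b := hlt
  have hb := b.isLt
  have hper : σ^[b - a] x = x := by
    refine (hσ.iterate a) ?_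
    rw [← Function.iterate_add_apply, show (a : ℕ) + (b - a) = b by omega]
    exact h.symm
  refine ⟨⟨n - (b - a), by omega⟩, ?_⟩
  have hsum : n - (b - a) + (b - a) = n := by omega
  have := Function.iterate_add_apply σ (n - (b - a)) (b - a) x
  rwa [hsum, hper] at this

/-- If two permutations differ at most by a transposition, and generate a transitive group, then one
of them is a full cycle and the other has at most two cycles. -/
theorem cycles_of_transitive {σ τ : Fin 5 → Fin 5} (hσ : Function.Injective σ)
    (hτ : Function.Injective τ)
    (hD : ∀ i j, i ≠ j → σ i ≠ τ i → σ j ≠ τ j → τ j = σ i)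
    (htr : ∀ S : Set (Fin 5), S.Nonempty → (∀ i ∈ S, σ i ∈ S) → (∀ i ∈ S, τ i ∈ S) →
      S = Set.univ) :
    (IsFullCycle σ ∧ IsFullCycle τ) ∨ (IsFullCycle σ ∧ IsTwoCycle τ) ∨
      (IsTwoCycle σ ∧ IsFullCycle τ) := by
  have hstep : ∀ x (k : Fin 5), ∃ l : Fin 5, σ (σ^[k] x) = σ^[l] x := by
    intro x k
    rw [← Function.iterate_succ_apply' σ]
    rcases Nat.lt_or_ge (k + 1) 5 with h | h
    · exact ⟨⟨k + 1, h⟩, rfl⟩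
    · rw [show (k : ℕ).succ = 5 by omega]
      exact exists_iterate_lt hσ x
  by_cases hne : ∃ i, σ i ≠ τ i
  · obtain ⟨i, hi⟩ := hne
    obtain ⟨j, hji, hj⟩ : ∃ j, j ≠ i ∧ σ j ≠ τ j := by
      by_contra hcon
      push Not at hcon
      obtain ⟨j, hj⟩ := (Finite.injective_iff_surjective.1 hσ) (τ i)
      rcases eq_or_ne j i with rfl | hji
      · exact hi hj
      · exact hji (hτ ((hcon j hji).symm.trans hj))
    have h1 := hD i j hji.symm hi hj
    have h2 := hD j i hji hj hi
    have h3 : ∀ z, z ≠ i → z ≠ j → τ z = σ z := by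
      intro z hzi hzj
      by_contra hz
      exact hzj (hτ ((hD i z hzi.symm hi (Ne.symm hz)).trans h1.symm))
    refine Or.inr (isFullCycle_or_isTwoCycle hσ hji.symm h2 h1 h3 fun z => ?_)
    have hS := htr {z | ∃ k : Fin 5, σ^[k] i = z ∨ σ^[k] j = z} ⟨i, 0, Or.inl rfl⟩ ?_ ?_
    · have hz := Set.mem_univ z
      rwa [← hS] at hz
    · rintro - ⟨k, rfl | rfl⟩
      · obtain ⟨l, hl⟩ := hstep i k
        exact ⟨l, Or.inl hl.symm⟩
      · obtain ⟨l, hl⟩ := hstep j k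
        exact ⟨l, Or.inr hl.symm⟩
    · intro z hz
      rcases eq_or_ne z i with rfl | hzi
      · exact ⟨1, Or.inr h2.symm⟩
      rcases eq_or_ne z j with rfl | hzj
      · exact ⟨1, Or.inl h1.symm⟩
      rw [h3 z hzi hzj]
      obtain ⟨k, rfl | rfl⟩ := hz
      · obtain ⟨l, hl⟩ := hstep i k
        exact ⟨l, Or.inl hl.symm⟩
      · obtain ⟨l, hl⟩ := hstep j k
        exact ⟨l, Or.inr hl.symm⟩
  · push Not at hne
    obtain rfl : σ = τ := funext hne
    have hfull : IsFullCycle σ := by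
      have hS : ∀ x, {z | ∃ k : Fin 5, σ^[k] x = z} = Set.univ := fun x => by
        refine htr _ ⟨x, 0, rfl⟩ ?_ ?_ <;>
        · rintro - ⟨k, rfl⟩
          obtain ⟨l, hl⟩ := hstep x k
          exact ⟨l, hl.symm⟩
      have horb : ∀ x z, ∃ k : Fin 5, σ^[k] x = z := fun x z => by
        have := Set.mem_univ z
        rwa [← hS x] at this
      refine ⟨0, ?_, horb 0⟩
      -- The five iterates of `0` are distinct, so the fifth one can only return to `0`.
      have hbij : Function.Bijective fun k : Fin 5 => σ^[k] 0 :=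
        Function.Surjective.bijective_of_nat_card_le (horb 0) le_rfl
      obtain ⟨k, hk⟩ := exists_iterate_lt hσ 0
      rcases Fin.eq_zero_or_eq_succ k with rfl | ⟨l, rfl⟩
      · exact hk
      · have hk : σ (σ^[4] 0) = σ (σ^[l] 0) := by
          rw [← Function.iterate_succ_apply' σ, ← Function.iterate_succ_apply' σ]
          exact hk
        have h4 := @hbij.1 4 l.castSucc (hσ hk)
        have := congrArg Fin.val h4
        simp at this
        omega
    exact Or.inl ⟨hfull, hfull⟩

section Lines

variable {A : (Fin 5 → ℂ) →ₗ[ℂ] (Fin 5 → ℂ)} {W : Fin 5 → Submodule ℂ (Fin 5 → ℂ)}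
  {σ : Fin 5 → Fin 5}

theorem map_pow_eq (hA : ∀ i, (W i).map A = W (σ i)) (n : ℕ) (i : Fin 5) :
    (W i).map (A ^ n) = W (σ^[n] i) := by
  induction n with
  | zero => exact Submodule.map_id _
  | succ n ih =>
    rw [pow_succ', Module.End.mul_eq_comp, Submodule.map_comp, ih, hA,
      Function.iterate_succ_apply']

/-- A polynomial in `A` which vanishes on a line vanishes on its translates by powers of `A`. -/
theorem le_ker_aeval_iterate (hA : ∀ i, (W i).map A = W (σ i)) (q : ℂ[X]) {x : Fin 5}
    (hx : W x ≤ LinearMap.ker (aeval A q)) (n : ℕ) :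
    W (σ^[n] x) ≤ LinearMap.ker (aeval A q) := by
  rw [← map_pow_eq hA n x]
  rintro - ⟨y, hy, rfl⟩
  have h1 : (aeval A q) ((A ^ n) y) = (A ^ n) ((aeval A q) y) := by
    have : aeval A q * A ^ n = A ^ n * aeval A q := by
      rw [← aeval_X_pow (R := ℂ) A (n := n), ← map_mul, ← map_mul, mul_comm]
    exact LinearMap.congr_fun this y
  rw [LinearMap.mem_ker, h1, LinearMap.mem_ker.1 (hx hy), map_zero]

theorem exists_le_ker_of_iterate_eq (hA : ∀ i, (W i).map A = W (σ i)) {v : Fin 5 → ℂ} {x : Fin 5}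
    (hv : W x = Submodule.span ℂ {v}) {n : ℕ} (hx : σ^[n] x = x) :
    ∃ t : ℂ, W x ≤ LinearMap.ker (aeval A (X ^ n - C t)) := by
  have h1 : (A ^ n) v ∈ W x := by
    have h2 := map_pow_eq hA n x
    rw [hx] at h2
    rw [← h2]
    exact Submodule.mem_map_of_mem (hv ▸ Submodule.mem_span_singleton_self v)
  rw [hv] at h1
  obtain ⟨t, ht⟩ := Submodule.mem_span_singleton.1 h1
  refine ⟨t, ?_⟩
  rw [hv, Submodule.span_singleton_le_iff_mem, LinearMap.mem_ker]
  simp [← ht, Module.algebraMap_end_apply]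

/-- The shape of a monic polynomial of degree five which is the characteristic polynomial of a
monomial matrix whose permutation is a full cycle. -/
theorem coeff_of_isFullCycle {q : ℤ[X]} (htop : ⨆ i, W i = ⊤)
    (hline : ∀ i, ∃ v, W i = Submodule.span ℂ {v})
    (hA : ∀ i, (W i).map (compOn ℂ q) = W (σ i)) (hσ : IsFullCycle σ) :
    q.coeff 1 = 0 ∧ q.coeff 2 = 0 ∧ q.coeff 3 = 0 ∧ q.coeff 4 = 0 := by
  obtain ⟨x, hx, hall⟩ := hσ
  obtain ⟨v, hv⟩ := hline x
  obtain ⟨t, ht⟩ := exists_le_ker_of_iterate_eq hA hv hx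
  have h0 : ∀ y, aeval (compOn ℂ q) (X ^ 5 - C t) y = 0 := by
    intro y
    have : (⊤ : Submodule ℂ (Fin 5 → ℂ)) ≤ LinearMap.ker (aeval (compOn ℂ q) (X ^ 5 - C t)) := by
      rw [← htop]
      refine iSup_le fun z => ?_
      obtain ⟨k, rfl⟩ := hall z
      exact le_ker_aeval_iterate hA _ ht k
    exact this Submodule.mem_top
  have h1 := h0 (Pi.single 0 1)
  have h4 := pow_compOn_single (K := ℂ) q 4
  simp only [map_sub, map_pow, aeval_X, aeval_C, LinearMap.sub_apply,
    Module.algebraMap_end_apply, pow_succ' (compOn ℂ q) 4, Module.End.mul_apply] at h1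
  rw [show (compOn ℂ q ^ 4) (Pi.single 0 1) = Pi.single 4 1 from h4, compOn_apply] at h1
  have e1 := congrFun h1 1
  have e2 := congrFun h1 2
  have e3 := congrFun h1 3
  have e4 := congrFun h1 4
  simp at e1 e2 e3 e4
  exact ⟨e1, e2, e3, e4⟩

/-- The shape of a monic polynomial of degree five which is the characteristic polynomial of a
monomial matrix whose permutation has two cycles: it is `(X - t)(X⁴ - r)` or
`(X² - t)(X³ - r)`. -/
theorem coeff_of_isTwoCycle {q : ℤ[X]} (htop : ⨆ i, W i = ⊤)
    (hline : ∀ i, ∃ v, W i = Submodule.span ℂ {v})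
    (hA : ∀ i, (W i).map (compOn ℂ q) = W (σ i)) (hσ : IsTwoCycle σ) :
    (q.coeff 2 = 0 ∧ q.coeff 3 = 0 ∧ q.coeff 0 = q.coeff 1 * q.coeff 4) ∨
    (q.coeff 1 = 0 ∧ q.coeff 4 = 0 ∧ q.coeff 0 = q.coeff 2 * q.coeff 3) := by
  obtain ⟨x, y, hxy, hall⟩ := hσ
  obtain ⟨v, hv⟩ := hline x
  obtain ⟨w, hw⟩ := hline y
  have key : ∀ m n : ℕ, σ^[m] x = x → σ^[n] y = y → ∃ t r : ℂ,
      ∀ z, aeval (compOn ℂ q) ((X ^ m - C t) * (X ^ n - C r)) z = 0 := by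
    intro m n hm hn
    obtain ⟨t, ht⟩ := exists_le_ker_of_iterate_eq hA hv hm
    obtain ⟨r, hr⟩ := exists_le_ker_of_iterate_eq hA hw hn
    refine ⟨t, r, fun z => ?_⟩
    have : (⊤ : Submodule ℂ (Fin 5 → ℂ)) ≤
        LinearMap.ker (aeval (compOn ℂ q) ((X ^ m - C t) * (X ^ n - C r))) := by
      rw [← htop]
      refine iSup_le fun z => ?_
      obtain ⟨k, rfl | rfl⟩ := hall z
      · refine le_ker_aeval_iterate hA _ (fun u hu => ?_) k
        rw [mul_comm, LinearMap.mem_ker, map_mul, Module.End.mul_apply,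
          LinearMap.mem_ker.1 (ht hu), map_zero]
      · refine le_ker_aeval_iterate hA _ (fun u hu => ?_) k
        rw [LinearMap.mem_ker, map_mul, Module.End.mul_apply,
          LinearMap.mem_ker.1 (hr hu), map_zero]
    exact this Submodule.mem_top
  have p1 := pow_compOn_single (K := ℂ) q 1
  have p2 := pow_compOn_single (K := ℂ) q 2
  have p3 := pow_compOn_single (K := ℂ) q 3
  have p4 := pow_compOn_single (K := ℂ) q 4
  rw [show ((1 : Fin 5) : ℕ) = 1 from rfl] at p1
  rw [show ((2 : Fin 5) : ℕ) = 2 from rfl] at p2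
  rw [show ((3 : Fin 5) : ℕ) = 3 from rfl] at p3
  rw [show ((4 : Fin 5) : ℕ) = 4 from rfl] at p4
  have p5 : (compOn ℂ q ^ 5) (Pi.single 0 1) = compOn ℂ q (Pi.single 4 1) := by
    rw [pow_succ', Module.End.mul_apply, p4]
  rcases hxy with ⟨hm, hn⟩ | ⟨hm, hn⟩
  · left
    obtain ⟨t, r, h⟩ := key 1 4 hm hn
    have e : (X ^ 1 - C t) * (X ^ 4 - C r) = X ^ 5 - C r * X ^ 1 - C t * X ^ 4 + C (t * r) := by
      rw [map_mul]; ring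
    have h1 := h (Pi.single 0 1)
    rw [e] at h1
    simp only [map_sub, map_add, map_mul, map_pow, aeval_X, aeval_C, LinearMap.sub_apply,
      LinearMap.add_apply, Module.algebraMap_end_apply, Module.End.mul_apply, p1, p4, p5,
      compOn_apply] at h1
    have e0 := congrFun h1 0
    have e1 := congrFun h1 1
    have e2 := congrFun h1 2
    have e3 := congrFun h1 3
    have e4 := congrFun h1 4
    simp only [Pi.sub_apply, Pi.add_apply, Pi.smul_apply, Pi.zero_apply] at e0 e1 e2 e3 e4
    simp at e0 e1 e2 e3 e4
    refine ⟨e2, e3, ?_⟩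
    have : (q.coeff 0 : ℂ) = q.coeff 1 * q.coeff 4 := by
      linear_combination -e0 + q.coeff 1 * e4 - t * e1
    exact_mod_cast this
  · right
    obtain ⟨t, r, h⟩ := key 2 3 hm hn
    have e : (X ^ 2 - C t) * (X ^ 3 - C r) = X ^ 5 - C r * X ^ 2 - C t * X ^ 3 + C (t * r) := by
      rw [map_mul]; ring
    have h1 := h (Pi.single 0 1)
    rw [e] at h1
    simp only [map_sub, map_add, map_mul, map_pow, aeval_X, aeval_C, LinearMap.sub_apply,
      LinearMap.add_apply, Module.algebraMap_end_apply, Module.End.mul_apply, p2, p3, p5,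
      compOn_apply] at h1
    have e0 := congrFun h1 0
    have e1 := congrFun h1 1
    have e2 := congrFun h1 2
    have e3 := congrFun h1 3
    have e4 := congrFun h1 4
    simp only [Pi.sub_apply, Pi.add_apply, Pi.smul_apply, Pi.zero_apply] at e0 e1 e2 e3 e4
    simp at e0 e1 e2 e3 e4
    refine ⟨e1, e4, ?_⟩
    have : (q.coeff 0 : ℂ) = q.coeff 2 * q.coeff 3 := by
      linear_combination -e0 + q.coeff 2 * e3 - t * e2
    exact_mod_cast this

end Lines

/-- A family of subspaces forming a direct sum, which is permuted by two maps without common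
invariant subspace, consists of `5` lines. -/
theorem exists_lines {f g : ℤ[X]} (h : IsLinearPair f g) {k : ℕ} (hk : 2 ≤ k)
    {W : Fin k → Submodule ℂ (Fin 5 → ℂ)} (hne : ∀ i, W i ≠ ⊥) (hW : DirectSum.IsInternal W)
    {σ τ : Fin k → Fin k} (hσ : ∀ i, (W i).map (compOn ℂ f) = W (σ i))
    (hτ : ∀ i, (W i).map (compOn ℂ g) = W (τ i)) :
    (∀ S : Set (Fin k), S.Nonempty → (∀ i ∈ S, σ i ∈ S) → (∀ i ∈ S, τ i ∈ S) → S = Set.univ) ∧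
    k = 5 ∧ ∀ i, Module.finrank ℂ (W i) = 1 := by
  have hind := hW.submodule_iSupIndep
  have htr : ∀ S : Set (Fin k), S.Nonempty → (∀ i ∈ S, σ i ∈ S) → (∀ i ∈ S, τ i ∈ S) →
      S = Set.univ := by
    rintro S ⟨i₀, hi₀⟩ hSσ hSτ
    have hle : ∀ i ∈ S, W i ≤ ⨆ i ∈ S, W i := fun i hi => le_biSup W hi
    rcases h.eq_bot_or_eq_top (U := ⨆ i ∈ S, W i)
      (by
        simp only [Submodule.map_iSup, hσ]
        exact iSup₂_le fun i hi => hle _ (hSσ i hi))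
      (by
        simp only [Submodule.map_iSup, hτ]
        exact iSup₂_le fun i hi => hle _ (hSτ i hi)) with hb | ht
    · exact absurd (le_bot_iff.1 ((hle i₀ hi₀).trans hb.le)) (hne i₀)
    · rw [Set.eq_univ_iff_forall]
      intro j
      by_contra hj
      refine hne j (disjoint_self.1 ((hind j).mono_right (le_top.trans (ht.ge.trans ?_))))
      exact iSup₂_le fun i hi => le_iSup₂_of_le i (by rintro rfl; exact hj hi) le_rfl
  refine ⟨htr, ?_⟩
  let i₀ : Fin k := ⟨0, by omega⟩
  have hdim : ∀ i, Module.finrank ℂ (W i) = Module.finrank ℂ (W i₀) := by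
    have hS := htr {i | Module.finrank ℂ (W i) = Module.finrank ℂ (W i₀)} ⟨i₀, rfl⟩
      (fun i hi => by
        have e := (Submodule.equivMapOfInjective _ h.injective_fst (W i)).finrank_eq
        rw [hσ] at e
        exact e.symm.trans hi)
      (fun i hi => by
        have e := (Submodule.equivMapOfInjective _ h.injective_snd (W i)).finrank_eq
        rw [hτ] at e
        exact e.symm.trans hi)
    intro i
    have := Set.mem_univ i
    rwa [← hS] at this
  have hsum : k * Module.finrank ℂ (W i₀) = 5 := by
    have h1 := Module.finrank_eq_card_basis
      (hW.collectedBasis fun i => Module.finBasis ℂ (W i))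
    simp only [Fintype.card_sigma, Fintype.card_fin, hdim, Finset.sum_const, Finset.card_univ,
      smul_eq_mul, Module.finrank_fintype_fun_eq_card] at h1
    exact h1.symm
  have hk5 : k = 5 := by
    rcases (Nat.dvd_prime Nat.prime_five).1 (Dvd.intro _ hsum) with h1 | h1
    · omega
    · exact h1
  refine ⟨hk5, fun i => ?_⟩
  rw [hdim i]
  subst hk5
  omega

/-- The maps `A` and `B` differ by a map of rank one, so that on lines which they permute, the two
permutations differ at most by a transposition. -/
theorem perm_differ {f g : ℤ[X]} {v : Fin 5 → Fin 5 → ℂ} (hv : LinearIndependent ℂ v)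
    {σ τ : Fin 5 → Fin 5} (hσi : Function.Injective σ) {a b : Fin 5 → ℂ}
    (ha : ∀ i, a i ≠ 0) (hσ : ∀ i, compOn ℂ f (v i) = a i • v (σ i))
    (hτ : ∀ i, compOn ℂ g (v i) = b i • v (τ i)) (i j : Fin 5) (hij : i ≠ j) (hi : σ i ≠ τ i)
    (hj : σ j ≠ τ j) : τ j = σ i := by
  let β := basisOfLinearIndependentOfCardEqFinrank hv (by simp)
  have hβ : ∀ n, β n = v n := fun n =>
    congrFun (coe_basisOfLinearIndependentOfCardEqFinrank hv (by simp)) n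
  have hrepr : ∀ n m, β.repr (v n) m = if n = m then 1 else 0 := fun n m => by
    rw [← hβ n, β.repr_self, Finsupp.single_apply]
  have hdiff : ∀ n, a n • v (σ n) - b n • v (τ n) = v n 4 • diffVec ℂ f g := fun n => by
    rw [← hσ, ← hτ, compOn_eq_add f g, add_sub_cancel_left]
  have hc : ∀ n, σ n ≠ τ n → v n 4 ≠ 0 := by
    intro n hn h0
    have h1 := hdiff n
    rw [h0, zero_smul] at h1
    have h2 := DFunLike.congr_fun (congrArg β.repr h1) (σ n)
    simp [hrepr, hn.symm] at h2
    exact ha n h2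
  by_contra hne
  have h1 : v j 4 • (a i • v (σ i) - b i • v (τ i)) = v i 4 • (a j • v (σ j) - b j • v (τ j)) := by
    rw [hdiff, hdiff, smul_smul, smul_smul, mul_comm]
  have h2 := DFunLike.congr_fun (congrArg β.repr h1) (σ i)
  simp [hrepr, hi.symm, hne, hσi.ne hij.symm] at h2
  rcases h2 with h2 | h2
  · exact hc j hj h2
  · exact ha i h2

theorem exists_perm {p : ℤ[X] × ℤ[X]} {k : ℕ} {W : Fin k → Submodule ℂ (Fin 5 → ℂ)}
    (hperm : ∀ γ ∈ hypergeometricGroup p, ∀ i, ∃ j, (W i).map (actOn ℂ γ) = W j)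
    {γ : GL (Fin 5) ℤ} (hγ : γ ∈ hypergeometricGroup p) {q : ℤ[X]}
    (hq : (γ : Matrix (Fin 5) (Fin 5) ℤ) = companionMatrix q) :
    ∃ σ : Fin k → Fin k, ∀ i, (W i).map (compOn ℂ q) = W (σ i) := by
  choose σ hσ using hperm γ hγ
  rw [actOn_eq_compOn ℂ hq] at hσ
  exact ⟨σ, hσ⟩

theorem injective_of_iSupIndep {k : ℕ} {W : Fin k → Submodule ℂ (Fin 5 → ℂ)}
    (hne : ∀ i, W i ≠ ⊥) (hind : iSupIndep W) {T : (Fin 5 → ℂ) →ₗ[ℂ] (Fin 5 → ℂ)}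
    (hT : Function.Injective T) {σ : Fin k → Fin k} (hσ : ∀ i, (W i).map T = W (σ i)) :
    Function.Injective σ := by
  intro i j hij
  have h1 : (W i).map T = (W j).map T := by rw [hσ, hσ, hij]
  exact hind.injective hne (Submodule.map_injective_of_injective hT h1)

/-- A system of imprimitivity consists of lines, with respect to which `A` and `B` are monomial. -/
theorem cycles_of_imprimitive {p : ℤ[X] × ℤ[X]} (h : IsLinearPair p.1 p.2) {k : ℕ} (hk : 2 ≤ k)
    {W : Fin k → Submodule ℂ (Fin 5 → ℂ)} (hne : ∀ i, W i ≠ ⊥) (hW : DirectSum.IsInternal W)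
    (hperm : ∀ γ ∈ hypergeometricGroup p, ∀ i, ∃ j, (W i).map (actOn ℂ γ) = W j) :
    ∃ (W : Fin 5 → Submodule ℂ (Fin 5 → ℂ)) (σ τ : Fin 5 → Fin 5), ⨆ i, W i = ⊤ ∧
      (∀ i, ∃ v, W i = Submodule.span ℂ {v}) ∧ (∀ i, (W i).map (compOn ℂ p.1) = W (σ i)) ∧
      (∀ i, (W i).map (compOn ℂ p.2) = W (τ i)) ∧
      ((IsFullCycle σ ∧ IsFullCycle τ) ∨ (IsFullCycle σ ∧ IsTwoCycle τ) ∨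
        (IsTwoCycle σ ∧ IsFullCycle τ)) := by
  obtain ⟨γ, hγ⟩ := exists_GL_companionMatrix (Or.inr h.coeff_fst)
  obtain ⟨δ, hδ⟩ := exists_GL_companionMatrix (Or.inl h.coeff_snd)
  obtain ⟨σ, hσ⟩ := exists_perm hperm (Subgroup.subset_closure (Or.inl hγ)) hγ
  obtain ⟨τ, hτ⟩ := exists_perm hperm (Subgroup.subset_closure (Or.inr hδ)) hδ
  obtain ⟨htr, rfl, hdim⟩ := exists_lines h hk hne hW hσ hτ
  have hind := hW.submodule_iSupIndep
  have hline : ∀ i, ∃ v, v ≠ 0 ∧ W i = Submodule.span ℂ {v} := fun i => by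
    obtain ⟨v, hv0, hv⟩ := finrank_eq_one_iff'.1 (hdim i)
    refine ⟨v, fun h0 => hv0 (Subtype.ext h0), le_antisymm (fun w hw => ?_) ?_⟩
    · obtain ⟨c, hc⟩ := hv ⟨w, hw⟩
      exact Submodule.mem_span_singleton.2 ⟨c, congrArg Subtype.val hc⟩
    · rw [Submodule.span_singleton_le_iff_mem]
      exact v.2
  refine ⟨W, σ, τ, hW.submodule_iSup_eq_top, fun i => (hline i).imp fun v hv => hv.2, hσ, hτ, ?_⟩
  choose v hv0 hv using hline
  have hvi : LinearIndependent ℂ v :=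
    hind.linearIndependent W (fun i => hv i ▸ Submodule.mem_span_singleton_self _) hv0
  have hσi := injective_of_iSupIndep hne hind h.injective_fst hσ
  have hτi := injective_of_iSupIndep hne hind h.injective_snd hτ
  have hcoef : ∀ {q : ℤ[X]} {ρ : Fin 5 → Fin 5}, (∀ i, (W i).map (compOn ℂ q) = W (ρ i)) →
      ∀ i, ∃ c : ℂ, compOn ℂ q (v i) = c • v (ρ i) := by
    intro q ρ hρ i
    have h1 : compOn ℂ q (v i) ∈ W (ρ i) := by
      rw [← hρ]
      exact Submodule.mem_map_of_mem (hv i ▸ Submodule.mem_span_singleton_self _)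
    rw [hv] at h1
    obtain ⟨c, hc⟩ := Submodule.mem_span_singleton.1 h1
    exact ⟨c, hc.symm⟩
  choose a ha using hcoef hσ
  choose b hb using hcoef hτ
  refine cycles_of_transitive hσi hτi (perm_differ hvi hσi (fun i h0 => ?_) ha hb) htr
  have h1 := ha i
  rw [h0, zero_smul] at h1
  exact hv0 i ((injective_iff_map_eq_zero _).1 h.injective_fst _ h1)

/-- The three pairs which are not primitive. -/
abbrev imprimitiveTable : List (List ℕ × List ℕ) :=
  [([1, 3, 4], [2, 10]), ([1, 5], [2, 10]), ([1, 8], [2, 10])]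

/-- Only row `0` of the grid consists of binomials, namely `X⁵ - 1` and `X⁵ + 1`. -/
theorem eq_zero_of_tail {i : Fin 14} (h : 1 - tailA i = 0 ∧ tailB i - tailA i = 0) :
    i = 0 := by
  revert i; decide

/-- Only rows `1` and `5` of the grid consist of polynomials `(X - t)(X⁴ - r)` or
`(X² - t)(X³ - r)`. -/
theorem eq_of_tail {i : Fin 14}
    (h : (tailB i - tailA i = 0 ∧ 1 = (1 - tailA i) * (1 - tailA i)) ∨
      (1 - tailA i = 0 ∧ 1 = (tailB i - tailA i) * (tailB i - tailA i))) : i = 1 ∨ i = 5 := by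
  revert i; decide

theorem isPrimitivePair_of_not_inTable {i j : Fin 14} (h : GridCoprime i j)
    (hT : ¬ InTable imprimitiveTable i j) : IsPrimitivePair (gridPair i j) := by
  have hlin := IsLinearPair.of_gridCoprime h
  constructor
  · intro U hU
    obtain ⟨γ, hγ⟩ := exists_GL_companionMatrix (Or.inr hlin.coeff_fst)
    obtain ⟨δ, hδ⟩ := exists_GL_companionMatrix (Or.inl hlin.coeff_snd)
    have h1 := hU γ (Subgroup.subset_closure (Or.inl hγ))
    have h2 := hU δ (Subgroup.subset_closure (Or.inr hδ))
    rw [actOn_eq_compOn ℂ hγ] at h1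
    rw [actOn_eq_compOn ℂ hδ] at h2
    exact hlin.eq_bot_or_eq_top h1 h2
  · rintro ⟨k, W', hk, hne, hW', hperm⟩
    obtain ⟨W, σ, τ, htop, hline, hσ, hτ, hcyc⟩ :=
      cycles_of_imprimitive hlin hk hne hW' hperm
    obtain ⟨f0, f1, f2, f3, f4, -⟩ := fPoly_coeff (tailA i) (tailB i)
    obtain ⟨g0, g1, g2, g3, g4, -⟩ := gPoly_coeff (tailA j) (tailB j)
    rw [gridPair_eq] at hσ hτ
    have fullf : IsFullCycle σ → i = 0 := fun hc => by
      obtain ⟨c1, c2, c3, c4⟩ := coeff_of_isFullCycle htop hline hσ hc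
      exact eq_zero_of_tail ⟨f1.symm.trans c1, f3.symm.trans c3⟩
    have fullg : IsFullCycle τ → j = 0 := fun hc => by
      obtain ⟨c1, c2, c3, c4⟩ := coeff_of_isFullCycle htop hline hτ hc
      exact eq_zero_of_tail ⟨g1.symm.trans c1, g3.symm.trans c3⟩
    have twof : IsTwoCycle σ → i = 1 ∨ i = 5 := fun hc => by
      refine eq_of_tail ?_
      have := coeff_of_isTwoCycle htop hline hσ hc
      rw [f0, f1, f2, f3, f4] at this
      refine this.imp (fun c => ⟨c.2.1, ?_⟩) (fun c => ⟨c.1, ?_⟩)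
      · linear_combination -c.2.2
      · linear_combination -c.2.2
    have twog : IsTwoCycle τ → j = 1 ∨ j = 5 := fun hc => by
      refine eq_of_tail ?_
      have := coeff_of_isTwoCycle htop hline hτ hc
      rw [g0, g1, g2, g3, g4] at this
      exact this.imp (fun c => ⟨c.2.1, c.2.2⟩) (fun c => ⟨c.1, c.2.2⟩)
    rcases hcyc with ⟨h1, h2⟩ | ⟨h1, h2⟩ | ⟨h1, h2⟩
    · obtain rfl := fullf h1
      obtain rfl := fullg h2
      exact hT (by decide)
    · obtain rfl := fullf h1
      rcases twog h2 with rfl | rfl <;> exact hT (by decide)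
    · obtain rfl := fullg h2
      rcases twof h1 with rfl | rfl <;> exact hT (by decide)

/-! ### The imprimitive pairs -/

/-- The action of the companion matrix of `X⁵ + c₄X⁴ + ⋯ + c₀` on integral vectors. -/
def compInt (c x : Fin 5 → ℤ) : Fin 5 → ℤ :=
  ![-c 0 * x 4, x 0 - c 1 * x 4, x 1 - c 2 * x 4, x 2 - c 3 * x 4, x 3 - c 4 * x 4]

theorem compOn_intCast (q : ℤ[X]) (c x : Fin 5 → ℤ) (hc : ∀ i : Fin 5, q.coeff i = c i) :
    compOn ℂ q (fun n => (x n : ℂ)) = fun n => (compInt c x n : ℂ) := by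
  have h0 : q.coeff 0 = c 0 := hc 0
  have h1 : q.coeff 1 = c 1 := hc 1
  have h2 : q.coeff 2 = c 2 := hc 2
  have h3 : q.coeff 3 = c 3 := hc 3
  have h4 : q.coeff 4 = c 4 := hc 4
  rw [compOn_apply]
  ext n
  fin_cases n <;> simp [compInt, h0, h1, h2, h3, h4]

/-- The coefficients of the first member of `gridPair i j`. -/
def fCoeff (i : Fin 14) : Fin 5 → ℤ :=
  ![-1, 1 - tailA i, tailA i - tailB i, tailB i - tailA i, tailA i - 1]

/-- The coefficients of the second member of `gridPair i j`. -/
def gCoeff (j : Fin 14) : Fin 5 → ℤ :=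
  ![1, 1 - tailA j, tailB j - tailA j, tailB j - tailA j, 1 - tailA j]

theorem coeff_gridPair (i j : Fin 14) : (∀ n : Fin 5, (gridPair i j).1.coeff n = fCoeff i n) ∧
    ∀ n : Fin 5, (gridPair i j).2.coeff n = gCoeff j n := by
  obtain ⟨f0, f1, f2, f3, f4, -⟩ := fPoly_coeff (tailA i) (tailB i)
  obtain ⟨g0, g1, g2, g3, g4, -⟩ := gPoly_coeff (tailA j) (tailB j)
  rw [gridPair_eq]
  generalize fPoly (tailA i) (tailB i) = f at *
  generalize gPoly (tailA j) (tailB j) = g at *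
  constructor
  · intro n
    match n with
    | 0 => exact f0
    | 1 => exact f1
    | 2 => exact f2
    | 3 => exact f3
    | 4 => exact f4
  · intro n
    match n with
    | 0 => exact g0
    | 1 => exact g1
    | 2 => exact g2
    | 3 => exact g3
    | 4 => exact g4

/-- In each of the three classes one member is `X⁵ ± 1`, whose companion matrix permutes the lines
through `e₁, …, e₅`; the lines sought are the translates under it of the line through
`e₁`, `e₁ ± e₂` or `e₁ + e₃`. -/
theorem exists_monomialVec : ∀ i j, InTable imprimitiveTable i j →
    ∃ x ∈ [![(1 : ℤ), 0, 0, 0, 0], ![1, 1, 0, 0, 0], ![1, -1, 0, 0, 0], ![1, 0, 1, 0, 0]],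
    ∃ c ∈ [fCoeff i, gCoeff j], (∃ n, x n ≠ 0) ∧
      (∀ n : Fin 5, ∃ m : Fin 5, compInt (fCoeff i) ((compInt c)^[n] x) = (compInt c)^[m] x ∨
        compInt (fCoeff i) ((compInt c)^[n] x) = -(compInt c)^[m] x) ∧
      ∀ n : Fin 5, ∃ m : Fin 5, compInt (gCoeff j) ((compInt c)^[n] x) = (compInt c)^[m] x ∨
        compInt (gCoeff j) ((compInt c)^[n] x) = -(compInt c)^[m] x := by
  decide +kernel

theorem map_span_singleton_of_intCast {q : ℤ[X]} {c x y : Fin 5 → ℤ}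
    (hc : ∀ i : Fin 5, q.coeff i = c i) (h : compInt c x = y ∨ compInt c x = -y) :
    (Submodule.span ℂ {fun n => (x n : ℂ)}).map (compOn ℂ q) =
      Submodule.span ℂ {fun n => (y n : ℂ)} := by
  rw [Submodule.map_span, Set.image_singleton, compOn_intCast q c x hc]
  rcases h with h | h
  · rw [h]
  · have : (fun n => (((-y) n : ℤ) : ℂ)) = -fun n => (y n : ℂ) := by
      ext n
      simp
    rw [h, this, ← Set.neg_singleton, Submodule.span_neg]

theorem not_isPrimitivePair_of_inTable {i j : Fin 14} (h : GridCoprime i j)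
    (hT : InTable imprimitiveTable i j) : ¬ IsPrimitivePair (gridPair i j) := by
  obtain ⟨x, -, c, -, ⟨n₀, hn₀⟩, hf, hg⟩ := exists_monomialVec i j hT
  have hlin := IsLinearPair.of_gridCoprime h
  obtain ⟨cf, cg⟩ := coeff_gridPair i j
  rintro ⟨-, hprim⟩
  let v : Fin 5 → Fin 5 → ℂ := fun n m => (((compInt c)^[n] x) m : ℂ)
  let W : Fin 5 → Submodule ℂ (Fin 5 → ℂ) := fun n => Submodule.span ℂ {v n}
  have hfW : ∀ n, ∃ m, (W n).map (compOn ℂ (gridPair i j).1) = W m := fun n => by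
    obtain ⟨m, hm⟩ := hf n
    exact ⟨m, map_span_singleton_of_intCast cf hm⟩
  have hgW : ∀ n, ∃ m, (W n).map (compOn ℂ (gridPair i j).2) = W m := fun n => by
    obtain ⟨m, hm⟩ := hg n
    exact ⟨m, map_span_singleton_of_intCast cg hm⟩
  have htop : ⨆ n, W n = ⊤ := by
    rcases hlin.eq_bot_or_eq_top (U := ⨆ n, W n)
      (by
        rw [Submodule.map_iSup]
        refine iSup_le fun n => ?_
        obtain ⟨m, hm⟩ := hfW n
        exact hm.le.trans (le_iSup W m))
      (by
        rw [Submodule.map_iSup]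
        refine iSup_le fun n => ?_
        obtain ⟨m, hm⟩ := hgW n
        exact hm.le.trans (le_iSup W m)) with hb | ht
    · have h0 : v 0 ∈ (⊥ : Submodule ℂ (Fin 5 → ℂ)) := by
        rw [← hb]
        exact le_iSup W 0 (Submodule.mem_span_singleton_self _)
      have h1 := congrFun ((Submodule.mem_bot ℂ).1 h0) n₀
      exact absurd (by simpa [v] using h1) hn₀
    · exact ht
  have hli : LinearIndependent ℂ v := by
    refine linearIndependent_of_top_le_span_of_card_eq_finrank ?_ (by simp)
    rw [Submodule.span_range_eq_iSup]
    exact htop.ge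
  have hind : iSupIndep W := hli.iSupIndep_span_singleton
  have hne : ∀ n, W n ≠ ⊥ := fun n => by
    rw [Ne, Submodule.span_singleton_eq_bot]
    exact hli.ne_zero n
  refine hprim ⟨5, W, by norm_num, hne,
    DirectSum.isInternal_submodule_of_iSupIndep_of_iSup_eq_top hind htop, ?_⟩
  refine hypergeometricGroup_induction ?_ ?_ ?_ ?_ ?_
  · intro γ hγ
    rwa [actOn_eq_compOn ℂ hγ]
  · intro γ hγ
    rwa [actOn_eq_compOn ℂ hγ]
  · intro n
    exact ⟨n, by rw [actOn_one, Submodule.map_id]⟩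
  · intro γ δ hγ hδ n
    obtain ⟨m, hm⟩ := hδ n
    obtain ⟨l, hl⟩ := hγ m
    exact ⟨l, by rw [actOn_mul, Submodule.map_comp, hm, hl]⟩
  · intro γ hγ n
    choose ρ hρ using hγ
    have hinj : Function.Injective (actOn ℂ γ) := by
      refine Function.LeftInverse.injective (g := actOn ℂ γ⁻¹) fun y => ?_
      have := actOn_inv_apply ℂ γ⁻¹ y
      rwa [inv_inv] at this
    obtain ⟨m, hm⟩ := (Finite.injective_iff_surjective.1
      (injective_of_iSupIndep hne hind hinj hρ)) n
    refine ⟨m, ?_⟩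
    rw [← hm, ← hρ, ← Submodule.map_comp, ← actOn_mul, inv_mul_cancel, actOn_one,
      Submodule.map_id]

/-! ### Polynomials in a power of the variable -/

theorem isPolynomialInPower_iff {p : ℤ[X] × ℤ[X]} (hp : IsAdmissible p) :
    IsPolynomialInPower p ↔ p = (X ^ 5 - 1, X ^ 5 + 1) := by
  constructor
  · rintro ⟨k, f₁, g₁, hk, hf, hg⟩
    have hdf := hp.natDegree_fst
    rw [hf, natDegree_comp, natDegree_X_pow] at hdf
    have hk5 : k = 5 := by
      rcases (Nat.dvd_prime Nat.prime_five).1 (Dvd.intro_left _ hdf) with h1 | h1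
      · omega
      · exact h1
    subst hk5
    obtain ⟨i, j, hij, rfl⟩ := hp.exists_gridPair
    rw [gridPair_eq] at hf hg
    have hcomp : ∀ (q : ℤ[X]) n, ¬ 5 ∣ n → (q.comp (X ^ 5)).coeff n = 0 := fun q n hn => by
      rw [← expand_eq_comp_X_pow, coeff_expand (by norm_num), if_neg hn]
    obtain ⟨f0, f1, f2, f3, f4, f5⟩ := fPoly_coeff (tailA i) (tailB i)
    obtain ⟨g0, g1, g2, g3, g4, g5⟩ := gPoly_coeff (tailA j) (tailB j)
    simp only at hf hg
    have hi := eq_zero_of_tail (i := i)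
      ⟨by rw [← f1, hf, hcomp _ _ (by norm_num)], by rw [← f3, hf, hcomp _ _ (by norm_num)]⟩
    have hj := eq_zero_of_tail (i := j)
      ⟨by rw [← g1, hg, hcomp _ _ (by norm_num)], by rw [← g3, hg, hcomp _ _ (by norm_num)]⟩
    subst hi hj
    rw [gridPair_eq]
    simp [fPoly, gPoly, tailA, tailB]
  · rintro rfl
    exact ⟨5, X - 1, X + 1, by norm_num, by simp, by simp⟩

/-! ### The classification -/

/-- The criteria in terms of the tables. They involve only the position in the grid, hence hold for
all members of a shift class at once. -/
theorem IsAdmissible.classification {p : ℤ[X] × ℤ[X]} (hp : IsAdmissible p) :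
    ((RootsInterlace p ↔ IsListed interlacingTable p) ∧
      (Finite (hypergeometricGroup p) ↔ IsListed interlacingTable p) ∧
      (HasSignature p 5 0 ↔ IsListed interlacingTable p) ∧
      (HasSignature p 4 1 ↔ IsListed realRankOneTable p) ∧
      (HasSignature p 3 2 ↔ IsListed realRankTwoTable p)) ∧
    (IsPrimitivePair p ↔ ¬ IsListed imprimitiveTable p) := by
  obtain ⟨i, j, h, rfl⟩ := hp.exists_gridPair
  obtain ⟨h0, h1, h2⟩ := tableSignature_eq_iff i j h
  rw [isListed_gridPair_iff (by decide +kernel : IsGridTable interlacingTable),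
    isListed_gridPair_iff (by decide +kernel : IsGridTable realRankOneTable),
    isListed_gridPair_iff (by decide +kernel : IsGridTable realRankTwoTable),
    isListed_gridPair_iff (by decide +kernel : IsGridTable imprimitiveTable),
    hasSignature_gridPair_iff h, hasSignature_gridPair_iff h, hasSignature_gridPair_iff h,
    finite_gridPair_iff h, ← h0, ← h1, ← h2]
  refine ⟨⟨(rootsInterlace_gridPair_iff h).trans h0.symm, Iff.rfl, ?_, ?_, ?_⟩,
    fun hP hT => not_isPrimitivePair_of_inTable h hT hP, isPrimitivePair_of_not_inTable h⟩ <;>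
  rcases tableSignature_mem i j with hs | hs | hs <;> rw [hs] <;> decide

theorem isListed_interlacingTable_of_imprimitiveTable {p : ℤ[X] × ℤ[X]}
    (h : IsListed imprimitiveTable p) : IsListed interlacingTable p := by
  obtain ⟨t, ht, htp⟩ := h
  exact ⟨t, (by decide : imprimitiveTable ⊆ interlacingTable) ht, htp⟩

theorem IsAdmissible.indefinite {p : ℤ[X] × ℤ[X]} (hp : IsAdmissible p)
    (h : ¬ IsListed interlacingTable p) :
    ¬ RootsInterlace p ∧ Infinite (hypergeometricGroup p) ∧ IsPrimitivePair p := by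
  obtain ⟨⟨hr, hf, -⟩, hprim⟩ := hp.classification
  exact ⟨fun hR => h (hr.1 hR), not_finite_iff_infinite.1 fun hF => h (hf.1 hF),
    hprim.2 fun hT => h (isListed_interlacingTable_of_imprimitiveTable hT)⟩

theorem not_isListed_of_disjoint {T T' : List (List ℕ × List ℕ)} (hT : T ⊆ fullTable)
    (hT' : T' ⊆ fullTable) (hd : T.Disjoint T') {p : ℤ[X] × ℤ[X]} (hp : IsAdmissible p)
    (h : IsListed T p) : ¬ IsListed T' p := by
  obtain ⟨t, ht, htp⟩ := h
  rintro ⟨t', ht', htp'⟩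
  obtain rfl := (existsUnique_listed hp).unique ⟨hT ht, htp⟩ ⟨hT' ht', htp'⟩
  exact hd ht ht'

theorem mainTheorem2 :
    -- there are exactly 77 pairs up to scalar shift, and they split as 4 + 17 + 56
    Nat.card ShiftClass = 77 ∧
    Nat.card {κ : ShiftClass // ∀ p : AdmissiblePair, ⟦p⟧ = κ →
      RootsInterlace p.1 ∧ Finite (hypergeometricGroup p.1) ∧ HasSignature p.1 5 0} = 4 ∧
    Nat.card {κ : ShiftClass // ∀ p : AdmissiblePair, ⟦p⟧ = κ →
      ¬ RootsInterlace p.1 ∧ Infinite (hypergeometricGroup p.1) ∧ IsPrimitivePair p.1 ∧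
        HasSignature p.1 4 1} = 17 ∧
    Nat.card {κ : ShiftClass // ∀ p : AdmissiblePair, ⟦p⟧ = κ →
      ¬ RootsInterlace p.1 ∧ Infinite (hypergeometricGroup p.1) ∧ IsPrimitivePair p.1 ∧
        HasSignature p.1 3 2} = 56 ∧
    -- the tables list these pairs
    interlacingTable.length = 4 ∧ realRankOneTable.length = 17 ∧ realRankTwoTable.length = 56 ∧
    (∀ t ∈ interlacingTable ++ realRankOneTable ++ realRankTwoTable, IsAdmissible (rowPair t)) ∧
    (∀ p, IsAdmissible p →
      ∃! t, t ∈ interlacingTable ++ realRankOneTable ++ realRankTwoTable ∧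
        ShiftEquiv (rowPair t) p) ∧
    (∀ p, IsAdmissible p →
      (RootsInterlace p ↔ IsListed interlacingTable p) ∧
      (Finite (hypergeometricGroup p) ↔ IsListed interlacingTable p) ∧
      (HasSignature p 5 0 ↔ IsListed interlacingTable p) ∧
      (HasSignature p 4 1 ↔ IsListed realRankOneTable p) ∧
      (HasSignature p 3 2 ↔ IsListed realRankTwoTable p)) ∧
    -- primitivity holds outside three of the four finite cases
    (∀ p, IsAdmissible p →
      (IsPrimitivePair p ↔
        ¬ IsListed [([1, 3, 4], [2, 10]), ([1, 5], [2, 10]), ([1, 8], [2, 10])] p) ∧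
      (IsPolynomialInPower p ↔ p = (X ^ 5 - 1, X ^ 5 + 1))) := by
  have s0 : interlacingTable ⊆ fullTable := fun t ht => by simp [ht]
  have s1 : realRankOneTable ⊆ fullTable := fun t ht => by simp [ht]
  have s2 : realRankTwoTable ⊆ fullTable := fun t ht => by simp [ht]
  refine ⟨card_shiftClass, ?_, ?_, ?_, rfl, rfl, rfl, fun t ht => isAdmissible_rowPair ht,
    fun p hp => existsUnique_listed hp, fun p hp => hp.classification.1,
    fun p hp => ⟨hp.classification.2, isPolynomialInPower_iff hp⟩⟩
  · refine card_class_of_isListed s0 (by decide +kernel) (fun p hp => ?_)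
      (P := fun p => RootsInterlace p ∧ Finite (hypergeometricGroup p) ∧ HasSignature p 5 0)
    obtain ⟨⟨hr, hf, hs, -⟩, -⟩ := hp.classification
    rw [hr, hf, hs, and_self, and_self]
  · refine card_class_of_isListed s1 (by decide +kernel) (fun p hp => ?_)
      (P := fun p => ¬ RootsInterlace p ∧ Infinite (hypergeometricGroup p) ∧ IsPrimitivePair p ∧
        HasSignature p 4 1)
    obtain ⟨⟨-, -, -, hs, -⟩, -⟩ := hp.classification
    refine ⟨fun h => hs.1 h.2.2.2, fun h => ?_⟩
    obtain ⟨h1, h2, h3⟩ := hp.indefinite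
      (not_isListed_of_disjoint s1 s0 (fun t ht ht' => by revert t; decide +kernel) hp h)
    exact ⟨h1, h2, h3, hs.2 h⟩
  · refine card_class_of_isListed s2 (by decide +kernel) (fun p hp => ?_)
      (P := fun p => ¬ RootsInterlace p ∧ Infinite (hypergeometricGroup p) ∧ IsPrimitivePair p ∧
        HasSignature p 3 2)
    obtain ⟨⟨-, -, -, -, hs⟩, -⟩ := hp.classification
    refine ⟨fun h => hs.1 h.2.2.2, fun h => ?_⟩
    obtain ⟨h1, h2, h3⟩ := hp.indefinite
      (not_isListed_of_disjoint s2 s0 (fun t ht ht' => by revert t; decide +kernel) hp h)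
    exact ⟨h1, h2, h3, hs.2 h⟩
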